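/- Let $(\Omega,\Sigma,P)$ be a probability space and $\Theta:\Omega\to\mathbb R$ a $P$-integrable random variable with $\Theta>0$ $P$-a.s. Let $N=\{N_t\}_{t\ge 0}$ be a counting process: each $N_t:\Omega\to\mathbb N_0$ is measurable and, for every $\omega\in\Omega$, $N_0=0$, $N_t=\inf_{s>t}N_s$ for $t\ge 0$, $\sup_{s<t}N_s\le N_t\le\sup_{s<t}N_s+1$ for $t>0$, and $\sup_tN_t=\infty$ (so the exceptional null set and the explosion are empty). Let $T_n=\inf\{t\ge 0:N_t=n\}$ for $n\ge 0$ and let $W_n=T_n-T_{n-1}$, $n\ge 1$, be the interarrival times. Let $X=\{X_n\}_{n\ge 1}$ be a sequence of random variables with values in $(0,\infty)$. Assume that $(N,X)$ is a risk process under $P$, i.e. $X$ is i.i.d. and the processes $N$ and $X$ are $P$-independent. Let $S_t=\sum_{k=1}^{N_t}X_k$ be the induced aggregate process. Assume that $X_1$ is $P$-integrable and that * (a1) the processes $W=\{W_n\}_{n\ge1}$ and $X$ are conditionally independent given $\sigma(\Theta)$ under $P$; * (a2) $\Theta$ and the sequence $X$ are $P$-independent. Let $P_\Theta$ be the law of $\Theta$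 on $(0,\infty)$ and let $\{P_\theta\}_{\theta\in(0,\infty)}$ be a regular conditional probability of $P$ over $P_\Theta$ consistent with $\Theta$: the $P_\theta$ are probability measures on $\Sigma$; for each $D\in\Sigma$ the map $\theta\mapsto P_\theta(D)$ is Borel measurable and $\int P_\theta(D)\,P_\Theta(d\theta)=P(D)$; and for each Borel set $B\subseteq(0,\infty)$ one has $P_\theta(\Theta^{-1}(B))=1$ for $P_\Theta$-a.a. $\theta\in B$. Put $\mathcal F_t=\sigma(\{S_s:s\le t\}\cup\{\Theta\})$ and $\mathcal F^{N,\Theta}_t=\sigma(\{N_s:s\le t\}\cup\{\Theta\})$. Then the following statements are equivalent. 1. $S$ is a compound mixed Poisson process under $P$ with parameters $\Theta$ and $P_{X_1}$ (a $P$-CMPP$(\Theta,P_{X_1})$), i.e. $S$ is induced by a risk process $(N',X')$ under $P$, with $X'_1$ distributed as $X_1$, such that $N'$ is a mixed Poisson process with parameter $\Theta$: given $\Theta$, $N'$ has conditionally independent and conditionally stationary increments, and for each $t>0$ the conditional distribution of $N'_t$ over $\Theta$ is, $P$-a.s., the Poisson distribution with parameter $t\Theta$. 2. $\{S_t-t\,\Theta\,\mathbb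 E_P[X_1]\}_{t\ge0}$ is an $(\mathcal F_t)$-martingale in $\mathcal L^1(P)$. 3. For $P_\Theta$-a.a. $\theta>0$, $\{S_t-t\,\theta\,\mathbb E_{P_\theta}[X_1]\}_{t\ge0}$ is an $(\mathcal F_t)$-martingale in $\mathcal L^1(P_\theta)$. 4. $\{N_t-t\,\Theta\}_{t\ge0}$ is an $(\mathcal F^{N,\Theta}_t)$-martingale in $\mathcal L^1(P)$. 5. For $P_\Theta$-a.a. $\theta>0$, $\{N_t-t\,\theta\}_{t\ge0}$ is an $(\mathcal F^{N,\Theta}_t)$-martingale in $\mathcal L^1(P_\theta)$. -/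

import Mathlib

open MeasureTheory ProbabilityTheory
open scoped NNReal ENNReal

namespace CompoundPoisson

variable {Ω : Type*} [mΩ : MeasurableSpace Ω]

/-- A (non-exploding) counting process, with empty exceptional null set: it starts at `0`, is
right-continuous and increasing (`N_t = inf_{s > t} N_s`), satisfies
`sup_{s < t} N_s ≤ N_t ≤ sup_{s < t} N_s + 1` for `t > 0` (a supremum of natural numbers that are
bounded by `N_t` is attained), and tends to infinity. -/
structure IsCountingProcess (N : ℝ≥0 → Ω → ℕ) : Prop where
  measurable : ∀ t, Measurable (N t)
  zero : ∀ ω, N 0 ω = 0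
  rightCont : ∀ t ω, N t ω = ⨅ s : Set.Ioi t, N s ω
  jump : ∀ t ω, 0 < t → (∀ s, s < t → N s ω ≤ N t ω) ∧ ∃ s, s < t ∧ N t ω ≤ N s ω + 1
  unbounded : ∀ ω (n : ℕ), ∃ t, n ≤ N t ω

/-- The arrival process `T_n = inf {t : N_t = n}` of a counting process. -/
noncomputable def arrival (N : ℝ≥0 → Ω → ℕ) (n : ℕ) (ω : Ω) : ℝ≥0 :=
  sInf {t | N t ω = n}

/-- The interarrival process; the index is shifted by one: `interarrival N n` is
`W_{n+1} = T_{n+1} - T_n`. -/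
noncomputable def interarrival (N : ℝ≥0 → Ω → ℕ) (n : ℕ) (ω : Ω) : ℝ :=
  (arrival N (n + 1) ω : ℝ) - (arrival N n ω : ℝ)

/-- The aggregate process `S_t = X_1 + ⋯ + X_{N_t}`. The index of the size process is shifted by
one: `X n` stands for the size `X_{n+1}`, so that `X 0` is the first claim size. -/
def aggregate (N : ℝ≥0 → Ω → ℕ) (X : ℕ → Ω → ℝ) (t : ℝ≥0) (ω : Ω) : ℝ :=
  ∑ k ∈ Finset.range (N t ω), X k ω

lemma measurable_aggregate {N : ℝ≥0 → Ω → ℕ} {X : ℕ → Ω → ℝ} (hN : ∀ t, Measurable (N t))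
    (hX : ∀ n, Measurable (X n)) (t : ℝ≥0) : Measurable (aggregate N X t) := by
  have h : Measurable fun p : ℕ × Ω => ∑ k ∈ Finset.range p.1, X k p.2 :=
    measurable_from_prod_countable_right
      fun n => Finset.measurable_sum (Finset.range n) fun k _ => hX k
  exact h.comp ((hN t).prodMk measurable_id)

/-- `(N, X)` is a risk process under `P`: `N` is a counting process, the claim sizes `X` are
positive and i.i.d., and the processes `N` and `X` are independent. -/
structure IsRiskProcess (P : Measure Ω) (N : ℝ≥0 → Ω → ℕ) (X : ℕ → Ω → ℝ) : Prop where
  counting : IsCountingProcess N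
  measurable_size : ∀ n, Measurable (X n)
  size_pos : ∀ n ω, 0 < X n ω
  size_indep : iIndepFun X P
  size_identDistrib : ∀ n, IdentDistrib (X n) (X 0) P P
  indep : IndepFun (fun ω t => N t ω) (fun ω n => X n ω) P

/-- The σ-algebra `σ(Θ)`. -/
abbrev sigmaOf (Θ : Ω → ℝ) : MeasurableSpace Ω := MeasurableSpace.comap Θ inferInstance

/-- Conditional independence, given `σ(Θ)`, of the σ-algebras `m₁` and `m₂`. -/
def CondIndepGiven (P : Measure Ω) (Θ : Ω → ℝ) (m₁ m₂ : MeasurableSpace Ω) : Prop :=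
  ∀ A B : Set Ω, MeasurableSet[m₁] A → MeasurableSet[m₂] B →
    P⟦A ∩ B | sigmaOf Θ⟧ =ᵐ[P] P⟦A | sigmaOf Θ⟧ * P⟦B | sigmaOf Θ⟧

/-- Conditional independence, given `σ(Θ)`, of a family of real random variables. -/
def ICondIndepFunGiven {ι : Type*} (P : Measure Ω) (Θ : Ω → ℝ) (Y : ι → Ω → ℝ) : Prop :=
  ∀ (s : Finset ι) (B : ι → Set ℝ), (∀ i, MeasurableSet (B i)) →
    P⟦⋂ i ∈ s, Y i ⁻¹' B i | sigmaOf Θ⟧ =ᵐ[P] ∏ i ∈ s, P⟦Y i ⁻¹' B i | sigmaOf Θ⟧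

/-- The processes `W` (interarrival times) and `X` are conditionally independent given `Θ`. -/
def ConditionA1 (P : Measure Ω) (N : ℝ≥0 → Ω → ℕ) (X : ℕ → Ω → ℝ) (Θ : Ω → ℝ) : Prop :=
  CondIndepGiven P Θ (⨆ n, MeasurableSpace.comap (interarrival N n) inferInstance)
    (⨆ n, MeasurableSpace.comap (X n) inferInstance)

/-- `Θ` and the sequence `X` are (unconditionally) independent. -/
def ConditionA2 (P : Measure Ω) (X : ℕ → Ω → ℝ) (Θ : Ω → ℝ) : Prop :=
  IndepFun Θ (fun ω n => X n ω) P

/-- The vector of the increments `N_{h + t_{j+1}} - N_{h + t_j}`, `j < m`. -/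
def increments (N : ℝ≥0 → Ω → ℕ) {m : ℕ} (t : Fin (m + 1) → ℝ≥0) (h : ℝ≥0) (ω : Ω) (j : Fin m) :
    ℝ :=
  (N (h + t j.succ) ω : ℝ) - (N (h + t j.castSucc) ω : ℝ)

/-- `N` has conditionally independent increments given `Θ`. -/
def HasCondIndepIncrements (P : Measure Ω) (N : ℝ≥0 → Ω → ℕ) (Θ : Ω → ℝ) : Prop :=
  ∀ (m : ℕ) (t : Fin (m + 1) → ℝ≥0), t 0 = 0 → StrictMono t →
    ICondIndepFunGiven P Θ (fun j ω => increments N t 0 ω j)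

/-- `N` has conditionally stationary increments given `Θ`: the vectors of increments over
`t_0 < ⋯ < t_m` and over `h + t_0 < ⋯ < h + t_m` are conditionally identically distributed. -/
def HasCondStationaryIncrements (P : Measure Ω) (N : ℝ≥0 → Ω → ℕ) (Θ : Ω → ℝ) : Prop :=
  ∀ (m : ℕ) (t : Fin (m + 1) → ℝ≥0), t 0 = 0 → StrictMono t → ∀ h : ℝ≥0,
    ∀ F : Set Ω, MeasurableSet[sigmaOf Θ] F → ∀ B : Set (Fin m → ℝ), MeasurableSet B →
      P (F ∩ increments N t h ⁻¹' B) = P (F ∩ increments N t 0 ⁻¹' B)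

/-- The counting process `N` is a mixed Poisson process with parameter `Θ`: it has conditionally
stationary independent increments and, for `t > 0`, the conditional distribution of `N_t` over `Θ`
is the Poisson distribution with parameter `t Θ`. -/
structure IsMixedPoisson (P : Measure Ω) (N : ℝ≥0 → Ω → ℕ) (Θ : Ω → ℝ) : Prop where
  counting : IsCountingProcess N
  indep : HasCondIndepIncrements P N Θ
  stationary : HasCondStationaryIncrements P N Θ
  condLaw : ∀ t : ℝ≥0, 0 < t → ∀ B : Set ℕ,
    P⟦N t ⁻¹' B | sigmaOf Θ⟧ =ᵐ[P] fun ω => (poissonMeasure (t * (Θ ω).toNNReal)).real B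

/-- `S` is a compound mixed Poisson process with parameters `Θ` and `ν`: it is induced by some risk
process whose counting process is mixed Poisson with parameter `Θ` and whose sizes have law `ν`. -/
def IsCMPP (P : Measure Ω) (Θ : Ω → ℝ) (ν : Measure ℝ) (S : ℝ≥0 → Ω → ℝ) : Prop :=
  ∃ (N : ℝ≥0 → Ω → ℕ) (X : ℕ → Ω → ℝ), IsRiskProcess P N X ∧ S = aggregate N X ∧
    P.map (X 0) = ν ∧ IsMixedPoisson P N Θ

/-- The distribution `P_Θ` of `Θ`, as a measure on `(0, ∞)`. -/
noncomputable def lawOn (P : Measure Ω) (Θ : Ω → ℝ) : Measure (Set.Ioi (0 : ℝ)) :=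
  (P.map Θ).comap Subtype.val

/-- The family `(P_θ)_{θ > 0}` is a regular conditional probability of `P` over `P_Θ` that is
consistent with `Θ`. That the `P_θ` are probability measures and that `θ ↦ P_θ(D)` is measurable
is the statement that the kernel `κ : θ ↦ P_θ` is a Markov kernel. -/
structure IsConsistentRCP (P : Measure Ω) (Θ : Ω → ℝ) (κ : Kernel (Set.Ioi (0 : ℝ)) Ω) : Prop where
  markov : IsMarkovKernel κ
  lintegral_eq : ∀ D : Set Ω, MeasurableSet D → ∫⁻ θ, κ θ D ∂(lawOn P Θ) = P D
  consistent : ∀ B : Set (Set.Ioi (0 : ℝ)), MeasurableSet B →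
    ∀ᵐ θ ∂(lawOn P Θ), θ ∈ B → κ θ (Θ ⁻¹' (Subtype.val '' B)) = 1

/-- The filtration `t ↦ σ({Z_s : s ≤ t} ∪ {Θ})`. -/
def filtrationWith {β : Type*} [MeasurableSpace β] (Z : ℝ≥0 → Ω → β) (Θ : Ω → ℝ)
    (hZ : ∀ t, Measurable (Z t)) (hΘ : Measurable Θ) : Filtration ℝ≥0 mΩ where
  seq t := (⨆ s : Set.Iic t, MeasurableSpace.comap (Z s) inferInstance) ⊔ sigmaOf Θ
  mono' s t hst := by
    refine sup_le_sup_right (iSup_le fun r => ?_) _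
    exact le_iSup (fun u : Set.Iic t => MeasurableSpace.comap (Z u) inferInstance)
      ⟨r.1, le_trans r.2 hst⟩
  le' t := sup_le (iSup_le fun s => (hZ s).comap_le) hΘ.comap_le

/-- The filtration `F_t = σ({S_s : s ≤ t} ∪ {Θ})` for the aggregate process `S` of `(N, X)`. -/
def filtrationS {P : Measure Ω} {N : ℝ≥0 → Ω → ℕ} {X : ℕ → Ω → ℝ} {Θ : Ω → ℝ}
    (h : IsRiskProcess P N X) (hΘ : Measurable Θ) : Filtration ℝ≥0 mΩ :=
  filtrationWith (aggregate N X) Θ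
    (measurable_aggregate h.counting.measurable h.measurable_size) hΘ

/-- The filtration `F^{N,Θ}_t = σ({N_s : s ≤ t} ∪ {Θ})`. -/
def filtrationN {P : Measure Ω} {N : ℝ≥0 → Ω → ℕ} {X : ℕ → Ω → ℝ} {Θ : Ω → ℝ}
    (h : IsRiskProcess P N X) (hΘ : Measurable Θ) : Filtration ℝ≥0 mΩ :=
  filtrationWith N Θ h.counting.measurable hΘ

end CompoundPoisson

open CompoundPoisson

/-! All five statements reduce to one: `N` has intensity `Θ`, that is, ∫_A (N_t - N_s) = (t - s) ∫_A
Θ for s ≤ t and every event A of the past at s of `N` and `Θ` (`HasIntensity`), under P or under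
almost every P_θ. For an increasing process started at 0 this is the martingale property of the
compensated process (`martingale_iff_hasIntensity`).

Between `N` and `S`: (a1) and (a2) together make (N, Θ) independent of X (`indep_of_conditions`). An
increment of `S` is the sum over l of X_l on {N_s ≤ l < N_t}. Intersected with a past event of `S`,
that set only involves N, Θ and the sizes before X_l, so X_l integrates out. This is Wald's identity
(`setLIntegral_aggregate`): passing from `N` to `S` multiplies by the mean size c, with 0 < c < ∞.
The past of `S` contains that of `N` and is contained in the past of `N` joined with σ(X), and the
join is harmless by independence (`IsCompoundModel.hasIntensity_aggregate_iff`).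

Between P and P_θ: the identity for one event can be disintegrated, but its exceptional null set
depends on the event. Countably many cylinder events on the grids of mesh 1/(n+1) suffice, because
right continuity recovers all times (`HasGridIntensity.hasIntensity`). Moreover P_θ is carried by {Θ
= θ}, and under it the sizes keep their law and their independence from (N, Θ)
(`IsConsistentRCP.ae_indep`).

Between mixed Poisson and intensity: one direction is the mean of the Poisson law, applied to grid
steps (`IsMixedPoisson.hasGridIntensity`). The other is Watanabe's theorem (`measure_increment_eq`):
along a partition one interpolates between z^(N_t - N_s) and the Poisson generating function. Each
step is a martingale increment with a past weight, up to a remainder that vanishes with the mesh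
because jumps have size one. A compound mixed Poisson representation of `S` may use another pair
(N', X'), but the jump times of `S` force N' = N (`counting_unique`). -/

namespace CompoundPoisson

open Filter Topology

/-! ### Paths of counting processes, partitions and grids -/

section Paths

variable {Ω : Type*} {mΩ : MeasurableSpace Ω} {N : ℝ≥0 → Ω → ℕ}

namespace IsCountingProcess

lemma monotone (h : IsCountingProcess N) (ω : Ω) : Monotone fun t => N t ω := by
  intro s t hst
  rcases hst.eq_or_lt with rfl | hlt
  · exact le_rfl
  · exact (h.jump t ω (lt_of_le_of_lt (zero_le) hlt)).1 s hlt

/-- An infimum of natural numbers is attained, so right continuity yields a u > t with N_u = N_t;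
monotonicity fills the interval. -/
lemma exists_const_right (h : IsCountingProcess N) (ω : Ω) (t : ℝ≥0) :
    ∃ u, t < u ∧ ∀ v, t ≤ v → v ≤ u → N v ω = N t ω := by
  have : Nonempty (Set.Ioi t) := ⟨⟨t + 1, by simp⟩⟩
  obtain ⟨⟨u, hu⟩, hu'⟩ := Nat.sInf_mem (Set.range_nonempty fun s : Set.Ioi t => N s ω)
  have hu2 : N u ω = N t ω := by rw [h.rightCont t ω]; exact hu'
  exact ⟨u, hu, fun v h1 h2 => le_antisymm (hu2 ▸ h.monotone ω h2) (h.monotone ω h1)⟩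

/-- The first time at which the path is at least k is attained by right continuity. There the value
is exactly k, since it is below k strictly before and jumps by at most one. Hence {T_k ≤ t} = {N_t ≥
k}, with T_k defined by hitting the value k. -/
lemma exists_isLeast (h : IsCountingProcess N) (ω : Ω) (k : ℕ) :
    ∃ T, N T ω = k ∧ ∀ t, T ≤ t ↔ k ≤ N t ω := by
  have hne : {t | k ≤ N t ω}.Nonempty := h.unbounded ω k
  set T := sInf {t | k ≤ N t ω} with hT
  have h1 : k ≤ N T ω := by
    obtain ⟨u, hu, hconst⟩ := h.exists_const_right ω T
    obtain ⟨v, hv, hvu⟩ := exists_lt_of_csInf_lt hne hu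
    rw [← hconst v (csInf_le (OrderBot.bddBelow _) hv) hvu.le]
    exact hv
  have h2 : ∀ t, k ≤ N t ω → T ≤ t := fun t ht => csInf_le (OrderBot.bddBelow _) ht
  refine ⟨T, le_antisymm ?_ h1, fun t => ⟨fun ht => h1.trans (h.monotone ω ht), h2 t⟩⟩
  rcases eq_or_ne T 0 with h0 | h0
  · rw [h0, h.zero]; exact Nat.zero_le _
  · obtain ⟨-, s, hs, hs'⟩ := h.jump T ω (pos_iff_ne_zero.2 h0)
    have : N s ω < k := by
      by_contra hcon
      exact absurd (h2 s (not_lt.1 hcon)) (not_le.2 hs)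
    omega

lemma arrival_eq (h : IsCountingProcess N) (ω : Ω) (k : ℕ) :
    N (arrival N k ω) ω = k ∧ ∀ t, arrival N k ω ≤ t ↔ k ≤ N t ω := by
  obtain ⟨T, hT, hT'⟩ := h.exists_isLeast ω k
  have : arrival N k ω = T :=
    IsLeast.csInf_eq ⟨hT, fun t (ht : N t ω = k) => (hT' t).2 ht.ge⟩
  rw [this]
  exact ⟨hT, hT'⟩

lemma arrival_le_iff (h : IsCountingProcess N) (ω : Ω) (k : ℕ) (t : ℝ≥0) :
    arrival N k ω ≤ t ↔ k ≤ N t ω := (h.arrival_eq ω k).2 t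

lemma arrival_zero (h : IsCountingProcess N) (ω : Ω) : arrival N 0 ω = 0 :=
  le_antisymm ((h.arrival_le_iff ω 0 0).2 (Nat.zero_le _)) (zero_le)

lemma arrival_lt_succ (h : IsCountingProcess N) (ω : Ω) (k : ℕ) :
    arrival N k ω < arrival N (k + 1) ω := by
  by_contra hcon
  have := (h.arrival_le_iff ω (k + 1) _).1 (not_lt.1 hcon)
  rw [(h.arrival_eq ω k).1] at this
  omega

/-- On a bounded time interval, jumps are separated by a positive distance. -/
lemma exists_gap (h : IsCountingProcess N) (ω : Ω) (T : ℝ≥0) :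
    ∃ ε : ℝ≥0, 0 < ε ∧ ∀ a b, b ≤ T → b < a + ε → N b ω ≤ N a ω + 1 := by
  have key : ∀ K : ℕ, ∃ ε : ℝ≥0, 0 < ε ∧
      ∀ k < K, arrival N k ω + ε ≤ arrival N (k + 1) ω := by
    intro K
    induction K with
    | zero => exact ⟨1, one_pos, by simp⟩
    | succ K ih =>
      obtain ⟨ε, hε, hK⟩ := ih
      have hlt := h.arrival_lt_succ ω K
      refine ⟨min ε (arrival N (K + 1) ω - arrival N K ω),
        lt_min hε (tsub_pos_of_lt hlt), fun k hk => ?_⟩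
      rcases Nat.lt_succ_iff_lt_or_eq.1 hk with hk | rfl
      · exact le_trans (by gcongr; exact min_le_left _ _) (hK k hk)
      · calc _ ≤ arrival N k ω + (arrival N (k + 1) ω - arrival N k ω) := by
              gcongr; exact min_le_right _ _
          _ = _ := add_tsub_cancel_of_le hlt.le
  obtain ⟨ε, hε, hgap⟩ := key (N T ω + 1)
  refine ⟨ε, hε, fun a b hb hab => ?_⟩
  -- Two jumps in (a, b] would be two consecutive arrivals, numbers N_a + 1 and N_a + 2, closer than
  -- ε; both have index at most N_T + 1, the range covered by `key`.
  by_contra hcon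
  have hbT := h.monotone ω hb
  have h1 : arrival N (N a ω + 1 + 1) ω ≤ b := (h.arrival_le_iff ω _ _).2 (by omega)
  have h2 : a < arrival N (N a ω + 1) ω := by
    by_contra h3
    have := (h.arrival_le_iff ω _ _).1 (not_lt.1 h3)
    omega
  have h3 := hgap (N a ω + 1) (by simp only at hbT; omega)
  exact absurd (hab.trans_le ((add_le_add_left h2.le ε).trans (h3.trans h1))) (lt_irrefl _)

end IsCountingProcess

lemma tendsto_const_div_add_one (c : ℝ≥0) :
    Tendsto (fun n : ℕ => c / ((n : ℝ≥0) + 1)) atTop (𝓝 0) := by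
  rw [← NNReal.tendsto_coe]
  have := (tendsto_const_div_atTop_nhds_zero_nat (c : ℝ)).comp (tendsto_add_atTop_nat 1)
  refine this.congr fun n => ?_
  simp

/-- The `i`-th point of the partition of `[s, t]` into `n + 1` intervals of equal length. -/
noncomputable def partPoint (s t : ℝ≥0) (n i : ℕ) : ℝ≥0 := s + (t - s) / (n + 1) * i

lemma partPoint_zero (s t : ℝ≥0) (n : ℕ) : partPoint s t n 0 = s := by simp [partPoint]

lemma partPoint_last {s t : ℝ≥0} (hst : s ≤ t) (n : ℕ) : partPoint s t n (n + 1) = t := by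
  have : ((n : ℝ≥0) + 1) ≠ 0 := by positivity
  rw [partPoint]
  push_cast
  rw [div_mul_cancel₀ _ this, add_tsub_cancel_of_le hst]

lemma partPoint_succ (s t : ℝ≥0) (n i : ℕ) :
    partPoint s t n (i + 1) = partPoint s t n i + (t - s) / (n + 1) := by
  simp only [partPoint]; push_cast; ring

lemma partPoint_mono (s t : ℝ≥0) (n : ℕ) : Monotone (partPoint s t n) :=
  monotone_nat_of_le_succ fun i => by rw [partPoint_succ]; exact le_self_add

lemma le_partPoint (s t : ℝ≥0) (n i : ℕ) : s ≤ partPoint s t n i := le_self_add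

lemma partPoint_le {s t : ℝ≥0} (hst : s ≤ t) {n i : ℕ} (hi : i ≤ n + 1) :
    partPoint s t n i ≤ t :=
  (partPoint_mono s t n hi).trans_eq (partPoint_last hst n)

/-- Along sufficiently fine partitions every interval contains at most one jump. -/
lemma IsCountingProcess.eventually_jump_le_one (h : IsCountingProcess N) (ω : Ω) {s t : ℝ≥0}
    (hst : s ≤ t) : ∀ᶠ n : ℕ in atTop, ∀ i ≤ n,
      N (partPoint s t n (i + 1)) ω ≤ N (partPoint s t n i) ω + 1 := by
  obtain ⟨ε, hε, hgap⟩ := h.exists_gap ω t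
  have hlim := tendsto_const_div_add_one (t - s)
  filter_upwards [hlim.eventually (gt_mem_nhds hε)] with n hn i hi
  refine hgap _ _ (partPoint_le hst (by omega)) ?_
  rw [partPoint_succ]
  exact add_lt_add_right hn _

/-- The smallest multiple of `1 / (n + 1)` that exceeds `x`, as a numerator. -/
noncomputable def gridNum (n : ℕ) (x : ℝ≥0) : ℕ := ⌊(n + 1 : ℝ≥0) * x⌋₊ + 1

/-- The point `i / (n + 1)`. -/
noncomputable def gridPoint (n i : ℕ) : ℝ≥0 := (i : ℝ≥0) / (n + 1)

lemma gridPoint_mono (n : ℕ) : Monotone (gridPoint n) := fun i j hij => by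
  simp only [gridPoint]; gcongr

lemma gridPoint_strictMono (n : ℕ) : StrictMono (gridPoint n) := fun i j hij => by
  have : (0 : ℝ≥0) < n + 1 := by positivity
  simp only [gridPoint]; gcongr

lemma gridNum_mono (n : ℕ) : Monotone (gridNum n) := fun x y hxy => by
  simp only [gridNum]; gcongr

lemma lt_gridPoint (n : ℕ) (x : ℝ≥0) : x < gridPoint n (gridNum n x) := by
  have : (0 : ℝ≥0) < n + 1 := by positivity
  rw [gridPoint, lt_div_iff₀ this, gridNum, mul_comm]
  push_cast
  exact Nat.lt_floor_add_one _

lemma gridPoint_le (n : ℕ) (x : ℝ≥0) : gridPoint n (gridNum n x) ≤ x + 1 / (n + 1) := by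
  have : (0 : ℝ≥0) < n + 1 := by positivity
  rw [gridPoint, gridNum, div_le_iff₀ this, add_mul x, div_mul_cancel₀ _ this.ne']
  push_cast
  gcongr
  rw [mul_comm x]
  exact Nat.floor_le (zero_le)

lemma gridPoint_le_add_one (n : ℕ) (x : ℝ≥0) : gridPoint n (gridNum n x) ≤ x + 1 := by
  refine (gridPoint_le n x).trans ?_
  gcongr
  rw [div_le_one (by positivity)]
  exact le_add_self

lemma tendsto_gridPoint (x : ℝ≥0) :
    Tendsto (fun n => gridPoint n (gridNum n x)) atTop (𝓝 x) := by
  have h0 : Tendsto (fun n : ℕ => x + 1 / ((n : ℝ≥0) + 1)) atTop (𝓝 x) := by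
    simpa using (tendsto_const_div_add_one 1).const_add x
  exact tendsto_of_tendsto_of_tendsto_of_le_of_le tendsto_const_nhds h0
    (fun n => (lt_gridPoint n x).le) (fun n => gridPoint_le n x)

/-- The grid points approach x from the right, where the path is locally constant, so the limit is
reached at a finite n. Countably many times therefore determine the whole process. -/
lemma IsCountingProcess.eventually_gridPoint (h : IsCountingProcess N) (ω : Ω) (x : ℝ≥0) :
    ∀ᶠ n in atTop, N (gridPoint n (gridNum n x)) ω = N x ω := by
  obtain ⟨u, hu, hconst⟩ := h.exists_const_right ω x
  filter_upwards [(tendsto_gridPoint x).eventually (gt_mem_nhds hu)] with n hn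
  exact hconst _ (lt_gridPoint n x).le hn.le

/-- The counting process is recovered by counting the changes of a process that jumps with it. -/
lemma IsCountingProcess.tendsto_count_changes (h : IsCountingProcess N) {S : ℝ≥0 → Ω → ℝ} (ω : Ω)
    (hS : ∀ s t, S s ω = S t ω ↔ N s ω = N t ω) (t : ℝ≥0) :
    Tendsto (fun n : ℕ => ∑ i ∈ Finset.range (n + 1),
      if S (partPoint 0 t n (i + 1)) ω = S (partPoint 0 t n i) ω then (0 : ℕ) else 1)
      atTop (𝓝 (N t ω)) := by
  refine tendsto_const_nhds.congr' ?_
  -- Once each cell holds at most one jump, the indicator of a change over a cell equals the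
  -- increment of `N`, and the sum telescopes.
  filter_upwards [h.eventually_jump_le_one ω (zero_le : 0 ≤ t)] with n hn
  have hsum : ∀ m ≤ n + 1, ∑ i ∈ Finset.range m,
      (if S (partPoint 0 t n (i + 1)) ω = S (partPoint 0 t n i) ω then (0 : ℕ) else 1)
        = N (partPoint 0 t n m) ω := by
    intro m
    induction m with
    | zero => intro _; simp [partPoint_zero, h.zero]
    | succ m ih =>
      intro hm
      rw [Finset.sum_range_succ, ih (by omega)]
      have h1 := hn m (by omega)
      have h2 := h.monotone ω (partPoint_mono 0 t n (Nat.le_succ m))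
      simp only [Nat.succ_eq_add_one] at h2
      simp only [hS]
      split_ifs <;> omega
  rw [hsum _ le_rfl, partPoint_last (zero_le)]

end Paths

/-! ### The aggregate process and the interarrival times determine the counting process -/

section Aggregate

variable {Ω : Type*} {mΩ : MeasurableSpace Ω} {N N' : ℝ≥0 → Ω → ℕ} {X X' : ℕ → Ω → ℝ}

lemma strictMono_partialSums {x : ℕ → ℝ} (hx : ∀ n, 0 < x n) :
    StrictMono fun n => ∑ k ∈ Finset.range n, x k :=
  strictMono_nat_of_lt_succ fun n => by
    rw [Finset.sum_range_succ]; linarith [hx n]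

lemma aggregate_eq_iff (hX : ∀ n ω, 0 < X n ω) (ω : Ω) (s t : ℝ≥0) :
    aggregate N X s ω = aggregate N X t ω ↔ N s ω = N t ω :=
  (strictMono_partialSums fun n => hX n ω).injective.eq_iff

/-- The aggregate process determines its counting process. -/
lemma counting_unique (hN : IsCountingProcess N) (hN' : IsCountingProcess N')
    (hX : ∀ n ω, 0 < X n ω) (hX' : ∀ n ω, 0 < X' n ω)
    (hS : aggregate N X = aggregate N' X') : N = N' := by
  funext t ω
  refine tendsto_nhds_unique (hN.tendsto_count_changes ω (aggregate_eq_iff hX ω) t) ?_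
  rw [hS]
  exact hN'.tendsto_count_changes ω (aggregate_eq_iff hX' ω) t

/-- The counting process is adapted to the filtration of the aggregate process. -/
lemma measurable_counting_of_aggregate (hN : IsCountingProcess N) (hX : ∀ n ω, 0 < X n ω)
    {m : MeasurableSpace Ω} {t : ℝ≥0} (hS : ∀ s ≤ t, Measurable[m] (aggregate N X s)) :
    Measurable[m] (N t) := by
  refine @measurable_of_tendsto_metrizable _ _ m _ _ _ _ (fun n ω => ∑ i ∈ Finset.range (n + 1),
      if aggregate N X (partPoint 0 t n (i + 1)) ω = aggregate N X (partPoint 0 t n i) ω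
      then (0 : ℕ) else 1) _ (fun n => ?_)
      (tendsto_pi_nhds.2 fun ω => hN.tendsto_count_changes ω (aggregate_eq_iff hX ω) t)
  refine Finset.measurable_sum _ fun i hi => ?_
  have hi' := Finset.mem_range.1 hi
  refine Measurable.ite ?_ measurable_const measurable_const
  exact measurableSet_eq_fun (hS _ (partPoint_le (zero_le) (by omega)))
    (hS _ (partPoint_le (zero_le) (by omega)))

/-- The counting process is measurable with respect to the interarrival times. -/
lemma measurable_counting_of_interarrival (hN : IsCountingProcess N) {m : MeasurableSpace Ω}
    (hW : ∀ n, Measurable[m] (interarrival N n)) (t : ℝ≥0) : Measurable[m] (N t) := by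
  have hT : ∀ k, Measurable[m] fun ω => (arrival N k ω : ℝ) := by
    intro k
    induction k with
    | zero => simpa only [hN.arrival_zero] using measurable_const
    | succ k ih =>
      have : (fun ω => (arrival N (k + 1) ω : ℝ))
          = fun ω => interarrival N k ω + (arrival N k ω : ℝ) := by
        funext ω; simp [interarrival]
      rw [this]
      exact (hW k).add ih
  refine measurable_of_Ici fun k => ?_
  have : N t ⁻¹' Set.Ici k = {ω | (arrival N k ω : ℝ) ≤ t} := by
    ext ω
    simp [hN.arrival_le_iff]
  rw [this]
  exact measurableSet_le (hT k) measurable_const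

lemma measurable_interarrival (hN : IsCountingProcess N) (n : ℕ) :
    Measurable (interarrival N n) := by
  have hT : ∀ k, Measurable (arrival N k) := by
    intro k
    refine measurable_of_Iic fun t => ?_
    have : arrival N k ⁻¹' Set.Iic t = N t ⁻¹' Set.Ici k := by
      ext ω
      simp [← hN.arrival_le_iff]
    rw [this]
    exact hN.measurable t measurableSet_Ici
  exact (hT _).coe_nnreal_real.sub (hT _).coe_nnreal_real

end Aggregate

/-! ### Intensities and martingales -/

section Intensity

variable {Ω : Type*} {mΩ : MeasurableSpace Ω} {μ : Measure Ω}

/-- The increments of `Z` over `(s, t]` have, on the events of the past, the mass that is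
prescribed by the intensity `Λ`. -/
def HasIntensity (μ : Measure Ω) (ℱ : Filtration ℝ≥0 mΩ) (Z : ℝ≥0 → Ω → ℝ) (Λ : Ω → ℝ) : Prop :=
  ∀ s t : ℝ≥0, s ≤ t → ∀ A, MeasurableSet[ℱ s] A →
    ∫⁻ ω in A, ENNReal.ofReal (Z t ω - Z s ω) ∂μ
      = ENNReal.ofReal (t - s) * ∫⁻ ω in A, ENNReal.ofReal (Λ ω) ∂μ

/-- The identity for s = 0 and the whole space computes the mean of Z_t. Integrability thus need not
be part of `HasIntensity`. -/
lemma HasIntensity.integrable {ℱ : Filtration ℝ≥0 mΩ} {Z : ℝ≥0 → Ω → ℝ} {Λ : Ω → ℝ}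
    (h : HasIntensity μ ℱ Z Λ) (hZm : ∀ t, Measurable (Z t)) (hmono : ∀ ω, Monotone fun t => Z t ω)
    (hZ0 : ∀ ω, Z 0 ω = 0) (hΛ : Integrable Λ μ) (t : ℝ≥0) : Integrable (Z t) μ := by
  refine ⟨(hZm t).aestronglyMeasurable, ?_⟩
  have hnn : ∀ ω, 0 ≤ Z t ω := fun ω => (hZ0 ω).symm.le.trans (hmono ω zero_le)
  rw [hasFiniteIntegral_iff_ofReal (Eventually.of_forall hnn)]
  have := h 0 t zero_le Set.univ MeasurableSet.univ
  simp only [hZ0, sub_zero, Measure.restrict_univ] at this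
  rw [this]
  refine ENNReal.mul_lt_top ENNReal.ofReal_lt_top ?_
  exact lt_of_le_of_lt (lintegral_mono fun ω => Real.ofReal_le_enorm (Λ ω)) hΛ.2

/-- Increments of Z and the intensity are nonnegative, so nothing is lost by passing to extended
nonnegative integrals. After rearranging, the identity on A says that the compensated process has
the same integral over A at s and at t, which characterises the conditional expectation. -/
lemma martingale_iff_hasIntensity [IsFiniteMeasure μ] {ℱ : Filtration ℝ≥0 mΩ}
    {Z : ℝ≥0 → Ω → ℝ} {Λ : Ω → ℝ} (hZm : ∀ t, Measurable[ℱ t] (Z t))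
    (hmono : ∀ ω, Monotone fun t => Z t ω) (hZ0 : ∀ ω, Z 0 ω = 0)
    (hΛm : Measurable[ℱ 0] Λ) (hΛ : Integrable Λ μ) (hΛ0 : 0 ≤ᵐ[μ] Λ) :
    Martingale (fun (t : ℝ≥0) ω => Z t ω - t * Λ ω) ℱ μ ↔ HasIntensity μ ℱ Z Λ := by
  have hZm' : ∀ t, Measurable (Z t) := fun t => (hZm t).mono (ℱ.le t) le_rfl
  have hadap : StronglyAdapted ℱ fun (t : ℝ≥0) ω => Z t ω - t * Λ ω := fun t =>
    ((hZm t).sub ((hΛm.mono (ℱ.mono zero_le) le_rfl).const_mul _)).stronglyMeasurable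
  have key : (∀ t, Integrable (Z t) μ) → ∀ s t : ℝ≥0, s ≤ t → ∀ A, MeasurableSet[ℱ s] A →
      (∫⁻ ω in A, ENNReal.ofReal (Z t ω - Z s ω) ∂μ
        = ENNReal.ofReal (t - s) * ∫⁻ ω in A, ENNReal.ofReal (Λ ω) ∂μ ↔
      ∫ ω in A, (Z t ω - t * Λ ω) ∂μ = ∫ ω in A, (Z s ω - s * Λ ω) ∂μ) := by
    intro hint s t hst A hA
    have hst' : (0 : ℝ) ≤ t - s := sub_nonneg.2 (NNReal.coe_le_coe.2 hst)
    have e1 : ∫⁻ ω in A, ENNReal.ofReal (Z t ω - Z s ω) ∂μ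
        = ENNReal.ofReal (∫ ω in A, (Z t ω - Z s ω) ∂μ) :=
      (ofReal_integral_eq_lintegral_ofReal ((hint t).sub (hint s)).integrableOn
        (Eventually.of_forall fun ω => sub_nonneg.2 (hmono ω hst))).symm
    have e2 : ∫⁻ ω in A, ENNReal.ofReal (Λ ω) ∂μ = ENNReal.ofReal (∫ ω in A, Λ ω ∂μ) :=
      (ofReal_integral_eq_lintegral_ofReal hΛ.integrableOn (ae_restrict_of_ae hΛ0)).symm
    have n1 : 0 ≤ ∫ ω in A, (Z t ω - Z s ω) ∂μ :=
      integral_nonneg fun ω => sub_nonneg.2 (hmono ω hst)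
    have n2 : 0 ≤ ∫ ω in A, Λ ω ∂μ := integral_nonneg_of_ae (ae_restrict_of_ae hΛ0)
    rw [e1, e2, ← ENNReal.ofReal_mul hst', ENNReal.ofReal_eq_ofReal_iff n1 (by positivity)]
    have hs : ∀ u : ℝ≥0, ∫ ω in A, (Z u ω - u * Λ ω) ∂μ
        = ∫ ω in A, Z u ω ∂μ - u * ∫ ω in A, Λ ω ∂μ := fun u => by
      rw [integral_sub (hint u).integrableOn (hΛ.const_mul _).integrableOn, integral_const_mul]
    rw [hs, hs, integral_sub (hint t).integrableOn (hint s).integrableOn]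
    constructor <;> intro h <;> linarith
  constructor
  · intro hM
    have hint : ∀ t, Integrable (Z t) μ := fun t => by
      have := (hM.integrable t).add (hΛ.const_mul (t : ℝ))
      refine this.congr (Eventually.of_forall fun ω => ?_)
      simp
    exact fun s t hst A hA => (key hint s t hst A hA).2 (hM.setIntegral_eq hst hA).symm
  · intro hI
    have hint := hI.integrable hZm' hmono hZ0 hΛ
    have hMint : ∀ t : ℝ≥0, Integrable (fun ω => Z t ω - t * Λ ω) μ := fun t =>
      (hint t).sub (hΛ.const_mul _)
    refine ⟨hadap, fun s t hst => ?_⟩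
    refine (ae_eq_condExp_of_forall_setIntegral_eq (ℱ.le s) (hMint t)
      (fun _ _ _ => (hMint s).integrableOn) (fun A hA _ => ?_)
      (hadap s).aestronglyMeasurable).symm
    exact ((key hint s t hst A hA).1 (hI s t hst A hA)).symm

/-- A martingale is orthogonal to bounded weights from the past. -/
lemma integral_mul_increment_eq [IsFiniteMeasure μ] {ℱ : Filtration ℝ≥0 mΩ} {M : ℝ≥0 → Ω → ℝ}
    (hM : Martingale M ℱ μ) {s t : ℝ≥0} (hst : s ≤ t) {ξ : Ω → ℝ} (hξ : Measurable[ℱ s] ξ)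
    {c : ℝ} (hc : ∀ᵐ ω ∂μ, ‖ξ ω‖ ≤ c) :
    ∫ ω, ξ ω * M t ω ∂μ = ∫ ω, ξ ω * M s ω ∂μ := by
  have h1 := condExp_stronglyMeasurable_mul_of_bound (ℱ.le s) hξ.stronglyMeasurable
    (hM.integrable t) c hc
  calc ∫ ω, ξ ω * M t ω ∂μ = ∫ ω, (μ[ξ * M t | ℱ s]) ω ∂μ := (integral_condExp (ℱ.le s)).symm
    _ = ∫ ω, ξ ω * (μ[M t | ℱ s]) ω ∂μ := integral_congr_ae h1
    _ = _ := integral_congr_ae (by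
      filter_upwards [hM.condExp_ae_eq hst] with ω hω
      rw [hω])

end Intensity

/-! ### Joins and traces of σ-algebras -/

section SigmaAlgebras

variable {Ω : Type*}

/-- Two finite measures that agree on intersections from `m₁` and `m₂` agree on `m₁ ⊔ m₂`. -/
lemma measure_eq_of_sup {m₁ m₂ mΩ : MeasurableSpace Ω} (h₁ : m₁ ≤ mΩ) (h₂ : m₂ ≤ mΩ)
    {μ ν : Measure Ω} [IsFiniteMeasure μ]
    (h : ∀ A B, MeasurableSet[m₁] A → MeasurableSet[m₂] B → μ (A ∩ B) = ν (A ∩ B))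
    {A : Set Ω} (hA : MeasurableSet[m₁ ⊔ m₂] A) : μ A = ν A := by
  have hgen : m₁ ⊔ m₂ = MeasurableSpace.generateFrom
      (Set.image2 (· ∩ ·) {s | MeasurableSet[m₁] s} {s | MeasurableSet[m₂] s}) := by
    refine le_antisymm (sup_le (fun A hA => ?_) fun B hB => ?_)
      (MeasurableSpace.generateFrom_le ?_)
    · exact MeasurableSpace.measurableSet_generateFrom
        ⟨A, hA, Set.univ, MeasurableSet.univ, Set.inter_univ A⟩
    · exact MeasurableSpace.measurableSet_generateFrom
        ⟨Set.univ, MeasurableSet.univ, B, hB, Set.univ_inter B⟩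
    · rintro _ ⟨A, hA, B, hB, rfl⟩
      exact MeasurableSet.inter (le_sup_left (a := m₁) (b := m₂) A hA)
        (le_sup_right (a := m₁) (b := m₂) B hB)
  refine ext_on_measurableSpace_of_generate_finite mΩ _ ?_ (sup_le h₁ h₂) hgen ?_ ?_ hA
  · rintro _ ⟨A, hA, B, hB, rfl⟩
    exact h A B hA hB
  · rintro _ ⟨A, hA, B, hB, rfl⟩ _ ⟨A', hA', B', hB', rfl⟩ -
    exact ⟨A ∩ A', hA.inter hA', B ∩ B', hB.inter hB', (Set.inter_inter_inter_comm _ _ _ _).symm⟩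
  · simpa using h Set.univ Set.univ MeasurableSet.univ MeasurableSet.univ

/-- The σ-algebra of the sets whose trace on `E` belongs to `m`. -/
@[reducible]
def traceSpace (m : MeasurableSpace Ω) {E : Set Ω} (hE : MeasurableSet[m] E) :
    MeasurableSpace Ω where
  MeasurableSet' A := MeasurableSet[m] (A ∩ E)
  measurableSet_empty := by simp
  measurableSet_compl A hA := by
    have : Aᶜ ∩ E = E \ (A ∩ E) := by ext; simp; tauto
    rw [this]; exact hE.diff hA
  measurableSet_iUnion f hf := by
    rw [Set.iUnion_inter]; exact MeasurableSet.iUnion hf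

/-- Localisation: to know the traces on E of the events of f, f may be replaced by any variable that
coincides with it on E. This serves to cut a random sum at a fixed number of terms. -/
lemma comap_le_traceSpace {β : Type*} [MeasurableSpace β] {m : MeasurableSpace Ω} {E : Set Ω}
    (hE : MeasurableSet[m] E) {f g : Ω → β} (hg : Measurable[m] g) (hfg : ∀ ω ∈ E, f ω = g ω) :
    MeasurableSpace.comap f inferInstance ≤ traceSpace m hE := by
  rintro _ ⟨B, hB, rfl⟩
  have : f ⁻¹' B ∩ E = g ⁻¹' B ∩ E := by
    ext ω
    simp only [Set.mem_inter_iff, Set.mem_preimage, and_congr_left_iff]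
    intro hω
    rw [hfg ω hω]
  change MeasurableSet[m] (f ⁻¹' B ∩ E)
  rw [this]
  exact (hg hB).inter hE

end SigmaAlgebras

/-! ### Wald's identity and the transfer of intensities between `N` and `S` -/

section Compound

variable {Ω : Type*} {mΩ : MeasurableSpace Ω} {μ : Measure Ω}

/-- The σ-algebra generated by the sequence `X`. -/
abbrev sizeSpace (X : ℕ → Ω → ℝ) : MeasurableSpace Ω :=
  ⨆ n, MeasurableSpace.comap (X n) inferInstance

lemma sizeSpace_eq_comap (X : ℕ → Ω → ℝ) :
    sizeSpace X = MeasurableSpace.comap (fun ω n => X n ω) inferInstance := by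
  simp only [MeasurableSpace.pi, MeasurableSpace.comap_iSup, MeasurableSpace.comap_comp]
  rfl

/-- The σ-algebra generated by the process `N` and by `Θ`. -/
abbrev countSpace (N : ℝ≥0 → Ω → ℕ) (Θ : Ω → ℝ) : MeasurableSpace Ω :=
  (⨆ t, MeasurableSpace.comap (N t) inferInstance) ⊔ sigmaOf Θ

/-- Under `μ`, the sizes are positive, independent, with common mean `c`, and independent of
`(N, Θ)`. -/
structure IsCompoundModel (μ : Measure Ω) (N : ℝ≥0 → Ω → ℕ) (X : ℕ → Ω → ℝ) (Θ : Ω → ℝ)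
    (c : ℝ≥0∞) : Prop where
  counting : IsCountingProcess N
  measurable_param : Measurable Θ
  measurable_size : ∀ n, Measurable (X n)
  size_pos : ∀ n ω, 0 < X n ω
  size_indep : iIndepFun X μ
  mean_eq : ∀ n, ∫⁻ ω, ENNReal.ofReal (X n ω) ∂μ = c
  indep : Indep (countSpace N Θ) (sizeSpace X) μ

variable {N : ℝ≥0 → Ω → ℕ} {X : ℕ → Ω → ℝ} {Θ : Ω → ℝ} {c : ℝ≥0∞}

/-- The σ-algebra generated by `N`, `Θ` and the sizes before the `l`-th one. -/
abbrev pastSpace (N : ℝ≥0 → Ω → ℕ) (X : ℕ → Ω → ℝ) (Θ : Ω → ℝ) (l : ℕ) : MeasurableSpace Ω :=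
  countSpace N Θ ⊔ ⨆ i ∈ Set.Iio l, MeasurableSpace.comap (X i) inferInstance

lemma measurable_count (t : ℝ≥0) : Measurable[countSpace N Θ] (N t) :=
  Measurable.of_comap_le ((le_iSup (fun t => MeasurableSpace.comap (N t) inferInstance) t).trans
    le_sup_left)

namespace IsCompoundModel

variable (h : IsCompoundModel μ N X Θ c)
include h

lemma countSpace_le : countSpace N Θ ≤ mΩ :=
  sup_le (iSup_le fun t => (h.counting.measurable t).comap_le) h.measurable_param.comap_le

lemma sizeSpace_le : sizeSpace X ≤ mΩ := iSup_le fun n => (h.measurable_size n).comap_le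

lemma pastSpace_le (l : ℕ) : pastSpace N X Θ l ≤ mΩ :=
  sup_le h.countSpace_le (iSup₂_le fun n _ => (h.measurable_size n).comap_le)

/-- On an intersection of an event of (N, Θ), one of the sizes before l and one of X_l, independence
of (N, Θ) from all sizes splits off the first factor and independence of the sizes separates the
other two. `measure_eq_of_sup` extends this to the join. -/
lemma indep_past [IsProbabilityMeasure μ] (l : ℕ) :
    Indep (pastSpace N X Θ l) (MeasurableSpace.comap (X l) inferInstance) μ := by
  have hle : (⨆ i ∈ Set.Iio l, MeasurableSpace.comap (X i) inferInstance) ≤ sizeSpace X :=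
    iSup₂_le fun i _ => le_iSup (fun n => MeasurableSpace.comap (X n) inferInstance) i
  have hX : Indep (⨆ i ∈ Set.Iio l, MeasurableSpace.comap (X i) inferInstance)
      (MeasurableSpace.comap (X l) inferInstance) μ := by
    have := indep_iSup_of_disjoint (fun n => (h.measurable_size n).comap_le) h.size_indep.iIndep
      (S := Set.Iio l) (T := {l}) (by simp)
    simpa using this
  rw [Indep_iff]
  intro A C hA hC
  have hCm : MeasurableSet C := (h.measurable_size l).comap_le C hC
  have hAm : MeasurableSet A := h.pastSpace_le l A hA
  have hCX : MeasurableSet[sizeSpace X] C :=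
    le_iSup (fun n => MeasurableSpace.comap (X n) inferInstance) l C hC
  have := measure_eq_of_sup (μ := μ.restrict C) (ν := μ C • μ) h.countSpace_le
    (hle.trans h.sizeSpace_le) (fun G B hG hB => ?_) hA
  · rw [Measure.restrict_apply hAm] at this
    rw [this, Measure.smul_apply, smul_eq_mul, mul_comm]
  · have hGm := h.countSpace_le G hG
    have hBm := h.sizeSpace_le B (hle B hB)
    rw [Measure.restrict_apply (hGm.inter hBm), Set.inter_assoc, Measure.smul_apply, smul_eq_mul,
      (Indep_iff _ _ _).1 h.indep G (B ∩ C) hG (MeasurableSet.inter (hle B hB) hCX),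
      (Indep_iff _ _ _).1 h.indep G B hG (hle B hB), (Indep_iff _ _ _).1 hX B C hB hC]
    ring

lemma measurable_aggregate : ∀ t, Measurable (aggregate N X t) :=
  CompoundPoisson.measurable_aggregate h.counting.measurable h.measurable_size

/-- On `{N_s ≤ l}` the past of the aggregate process only involves the first `l` sizes. -/
lemma measurableSet_past {s : ℝ≥0} {A : Set Ω}
    (hA : MeasurableSet[filtrationWith (aggregate N X) Θ h.measurable_aggregate
      h.measurable_param s] A) (l : ℕ) :
    MeasurableSet[pastSpace N X Θ l] (A ∩ {ω | N s ω ≤ l}) := by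
  have hNm : ∀ t, Measurable[pastSpace N X Θ l] (N t) := fun t =>
    (measurable_count t).mono le_sup_left le_rfl
  have hE : MeasurableSet[pastSpace N X Θ l] {ω | N s ω ≤ l} := hNm s measurableSet_Iic
  suffices hle : filtrationWith (aggregate N X) Θ h.measurable_aggregate
      h.measurable_param s ≤ traceSpace _ hE from hle A hA
  refine sup_le (iSup_le fun u => ?_) ?_
  -- On {N_s ≤ l} a sum with random upper limit N_u, u ≤ s, equals a sum over the fixed range of
  -- length l with indicators {i < N_u}.
  · refine comap_le_traceSpace hE
      (g := fun ω => ∑ i ∈ Finset.range l, if i < N u ω then X i ω else 0) ?_ fun ω hω => ?_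
    · refine Finset.measurable_sum _ fun i hi => ?_
      refine Measurable.ite ?_ (Measurable.of_comap_le ?_) measurable_const
      · exact hNm u measurableSet_Ioi
      · refine le_trans ?_ le_sup_right
        exact le_iSup₂ (f := fun i (_ : i ∈ Set.Iio l) =>
          MeasurableSpace.comap (X i) inferInstance) i (Finset.mem_range.1 hi)
    · have hu : N u ω ≤ l := (h.counting.monotone ω u.2).trans hω
      rw [aggregate, ← Finset.sum_filter]
      congr 1
      ext i
      simp only [Finset.mem_range, Finset.mem_filter]
      omega
  · exact comap_le_traceSpace hE (Measurable.of_comap_le (le_sup_right.trans le_sup_left))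
      fun _ _ => rfl

/-- As a series over fixed indices, each term pairs X_l with an event of `N`, so that the integral
can be taken term by term. -/
lemma aggregate_increment {s t : ℝ≥0} (hst : s ≤ t) (ω : Ω) :
    ENNReal.ofReal (aggregate N X t ω - aggregate N X s ω)
      = ∑' l, {ω | N s ω ≤ l ∧ l < N t ω}.indicator (fun ω => ENNReal.ofReal (X l ω)) ω := by
  have hmono := h.counting.monotone ω hst
  rw [aggregate, aggregate, ← Finset.sum_Ico_eq_sub _ hmono,
    ENNReal.ofReal_sum_of_nonneg fun i _ => (h.size_pos i ω).le,
    tsum_eq_sum (s := Finset.Ico (N s ω) (N t ω))]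
  · refine Finset.sum_congr rfl fun l hl => ?_
    rw [Set.indicator_of_mem]
    simpa using hl
  · intro l hl
    rw [Set.indicator_of_notMem]
    simpa using hl

lemma count_increment {s t : ℝ≥0} (hst : s ≤ t) (ω : Ω) :
    ENNReal.ofReal ((N t ω : ℝ) - N s ω)
      = ∑' l : ℕ, {ω | N s ω ≤ l ∧ l < N t ω}.indicator (fun _ => (1 : ℝ≥0∞)) ω := by
  have hmono := h.counting.monotone ω hst
  rw [tsum_eq_sum (s := Finset.Ico (N s ω) (N t ω))]
  · rw [Finset.sum_congr rfl fun l hl =>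
      Set.indicator_of_mem (a := ω) (s := {ω | N s ω ≤ l ∧ l < N t ω}) (by simpa using hl) _]
    simp only [Finset.sum_const, Nat.card_Ico, nsmul_eq_mul, mul_one]
    rw [← Nat.cast_sub hmono, ENNReal.ofReal_natCast]
  · intro l hl
    rw [Set.indicator_of_notMem]
    simpa using hl

/-- Wald's identity for the increments, on the events of the past. -/
lemma setLIntegral_aggregate [IsProbabilityMeasure μ] {s t : ℝ≥0} (hst : s ≤ t) {A : Set Ω}
    (hA : MeasurableSet[filtrationWith (aggregate N X) Θ h.measurable_aggregate
      h.measurable_param s] A) :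
    ∫⁻ ω in A, ENNReal.ofReal (aggregate N X t ω - aggregate N X s ω) ∂μ
      = c * ∫⁻ ω in A, ENNReal.ofReal ((N t ω : ℝ) - N s ω) ∂μ := by
  have hAm : MeasurableSet A := Filtration.le _ s A hA
  have hEm : ∀ l : ℕ, MeasurableSet {ω | N s ω ≤ l ∧ l < N t ω} := fun l =>
    (h.counting.measurable s measurableSet_Iic).inter (h.counting.measurable t measurableSet_Ioi)
  simp only [h.aggregate_increment hst, h.count_increment hst]
  rw [lintegral_tsum fun l =>
      ((h.measurable_size l).ennreal_ofReal.indicator (hEm l)).aemeasurable,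
    lintegral_tsum fun l => (measurable_const.indicator (hEm l)).aemeasurable,
    ← ENNReal.tsum_mul_left]
  refine tsum_congr fun l => ?_
  -- The constraint N_s ≤ l removes X_l and later sizes from A, which makes the event independent of
  -- X_l. The other constraint l < N_t looks into the future of `N` only, and all of `N` belongs to
  -- the past σ-algebra.
  have hpast : MeasurableSet[pastSpace N X Θ l] ({ω | N s ω ≤ l ∧ l < N t ω} ∩ A) := by
    have h1 := h.measurableSet_past hA l
    have h2 : MeasurableSet[pastSpace N X Θ l] {ω | l < N t ω} :=
      ((measurable_count t).mono (le_sup_left : _ ≤ pastSpace N X Θ l) le_rfl) measurableSet_Ioi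
    convert h1.inter h2 using 1
    ext ω
    simp only [Set.mem_inter_iff, Set.mem_ofPred_eq]
    tauto
  rw [setLIntegral_indicator (hEm l), setLIntegral_indicator (hEm l),
    ← lintegral_indicator ((hEm l).inter hAm), ← lintegral_indicator ((hEm l).inter hAm)]
  have hind := lintegral_mul_eq_lintegral_mul_lintegral_of_independent_measurableSpace
    (h.pastSpace_le l) (h.measurable_size l).comap_le (h.indep_past l)
    (f := ({ω | N s ω ≤ l ∧ l < N t ω} ∩ A).indicator fun _ => (1 : ℝ≥0∞))
    (g := fun ω => ENNReal.ofReal (X l ω))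
    (measurable_const.indicator hpast) (Measurable.ennreal_ofReal (comap_measurable (X l)))
  rw [h.mean_eq, mul_comm] at hind
  rw [← hind]
  refine lintegral_congr fun ω => ?_
  by_cases hω : ω ∈ {ω | N s ω ≤ l ∧ l < N t ω} ∩ A
  · simp [Set.indicator_of_mem hω]
  · simp [Set.indicator_of_notMem hω]

/-- The aggregate process has intensity `c Θ` if and only if the counting process has
intensity `Θ`. -/
lemma hasIntensity_aggregate_iff [IsProbabilityMeasure μ] (hc0 : c ≠ 0) (hc : c ≠ ∞)
    (hΘ : Integrable Θ μ) :
    HasIntensity μ (filtrationWith (aggregate N X) Θ h.measurable_aggregate h.measurable_param)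
      (aggregate N X) (fun ω => Θ ω * c.toReal) ↔
    HasIntensity μ (filtrationWith N Θ h.counting.measurable h.measurable_param)
      (fun t ω => (N t ω : ℝ)) Θ := by
  have hscale : ∀ A, ∫⁻ ω in A, ENNReal.ofReal (Θ ω * c.toReal) ∂μ
      = c * ∫⁻ ω in A, ENNReal.ofReal (Θ ω) ∂μ := fun A => by
    rw [← lintegral_const_mul _ h.measurable_param.ennreal_ofReal]
    refine lintegral_congr fun ω => ?_
    rw [mul_comm, ENNReal.ofReal_mul ENNReal.toReal_nonneg, ENNReal.ofReal_toReal hc]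
  have key : ∀ s t : ℝ≥0, s ≤ t → ∀ A, MeasurableSet[filtrationWith (aggregate N X) Θ
      h.measurable_aggregate h.measurable_param s] A →
      (∫⁻ ω in A, ENNReal.ofReal (aggregate N X t ω - aggregate N X s ω) ∂μ
        = ENNReal.ofReal (t - s) * ∫⁻ ω in A, ENNReal.ofReal (Θ ω * c.toReal) ∂μ ↔
      ∫⁻ ω in A, ENNReal.ofReal ((N t ω : ℝ) - N s ω) ∂μ
        = ENNReal.ofReal (t - s) * ∫⁻ ω in A, ENNReal.ofReal (Θ ω) ∂μ) := by
    intro s t hst A hA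
    rw [h.setLIntegral_aggregate hst hA, hscale, mul_left_comm,
      ENNReal.mul_right_inj hc0 hc]
  constructor
  · intro hS s t hst A hA
    have hle : filtrationWith N Θ h.counting.measurable h.measurable_param s
        ≤ filtrationWith (aggregate N X) Θ h.measurable_aggregate h.measurable_param s := by
      refine sup_le (iSup_le fun u => ?_) le_sup_right
      refine Measurable.comap_le ?_
      refine measurable_counting_of_aggregate h.counting h.size_pos fun v hv => ?_
      refine Measurable.of_comap_le (le_trans ?_ le_sup_left)
      exact le_iSup (fun w : Set.Iic s => MeasurableSpace.comap (aggregate N X w) inferInstance)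
        ⟨v, hv.trans u.2⟩
    exact (key s t hst A (hle A hA)).1 (hS s t hst A (hle A hA))
  · intro hN s t hst A hA
    refine (key s t hst A hA).2 ?_
    have hFN := (filtrationWith N Θ h.counting.measurable h.measurable_param).le s
    have hcount : filtrationWith N Θ h.counting.measurable h.measurable_param s
        ≤ countSpace N Θ :=
      sup_le (iSup_le fun u => (measurable_count u.1).comap_le) le_sup_right
    -- The past of `S` is larger than that of `N`, so the identity has to be extended from the past
    -- of `N` to its join with σ(X).
    have hle : filtrationWith (aggregate N X) Θ h.measurable_aggregate h.measurable_param s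
        ≤ filtrationWith N Θ h.counting.measurable h.measurable_param s ⊔ sizeSpace X := by
      refine sup_le (iSup_le fun u => ?_) (le_sup_right.trans le_sup_left)
      have hm : Measurable[filtrationWith N Θ h.counting.measurable h.measurable_param s
          ⊔ sizeSpace X] (aggregate N X u) := by
        -- The constant family with value `N u` is used, because only times up to s are measurable
        -- for this σ-algebra.
        refine @CompoundPoisson.measurable_aggregate Ω (_) (fun _ => N u) X (fun _ => ?_)
          (fun n => ?_) u
        · refine Measurable.of_comap_le (le_trans ?_ (le_sup_left.trans le_sup_left))
          exact le_iSup (fun w : Set.Iic s => MeasurableSpace.comap (N w) inferInstance) u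
        · refine Measurable.of_comap_le ?_
          exact (le_iSup (fun n => MeasurableSpace.comap (X n) inferInstance) n).trans le_sup_right
      exact hm.comap_le
    set f : Ω → ℝ≥0∞ := fun ω => ENNReal.ofReal ((N t ω : ℝ) - N s ω) with hf
    set g : Ω → ℝ≥0∞ := fun ω => ENNReal.ofReal (t - s) * ENNReal.ofReal (Θ ω) with hg
    have hfm : Measurable[countSpace N Θ] f :=
      (((measurable_from_top (f := fun n : ℕ => (n : ℝ))).comp (measurable_count t)).sub
        ((measurable_from_top (f := fun n : ℕ => (n : ℝ))).comp
          (measurable_count s))).ennreal_ofReal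
    have hΘm : Measurable[countSpace N Θ] Θ := Measurable.of_comap_le le_sup_right
    have hgm : Measurable[countSpace N Θ] g := hΘm.ennreal_ofReal.const_mul _
    have hNfg : ∀ G, MeasurableSet[filtrationWith N Θ h.counting.measurable
        h.measurable_param s] G → ∫⁻ ω in G, f ω ∂μ = ∫⁻ ω in G, g ω ∂μ := fun G hG => by
      rw [hN s t hst G hG, lintegral_const_mul _ h.measurable_param.ennreal_ofReal]
    have hgfin : ∫⁻ ω, g ω ∂μ ≠ ∞ := by
      rw [lintegral_const_mul _ h.measurable_param.ennreal_ofReal]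
      refine ENNReal.mul_ne_top ENNReal.ofReal_ne_top (ne_of_lt ?_)
      exact lt_of_le_of_lt (lintegral_mono fun ω => Real.ofReal_le_enorm (Θ ω)) hΘ.2
    have hffin : ∫⁻ ω, f ω ∂μ ≠ ∞ := by
      have := hNfg Set.univ MeasurableSet.univ
      simp only [Measure.restrict_univ] at this
      rwa [this]
    have : IsFiniteMeasure (μ.withDensity f) := isFiniteMeasure_withDensity hffin
    -- Both densities are functions of (N, Θ), so an event B of the sizes only contributes the
    -- factor μ(B), the same on both sides.
    have hprod : ∀ k : Ω → ℝ≥0∞, Measurable[countSpace N Θ] k → ∀ G B,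
        MeasurableSet[countSpace N Θ] G → MeasurableSet[sizeSpace X] B →
        ∫⁻ ω in G ∩ B, k ω ∂μ = (∫⁻ ω in G, k ω ∂μ) * μ B := by
      intro k hk G B hG hB
      have hGm := h.countSpace_le G hG
      have hBm := h.sizeSpace_le B hB
      have hi := lintegral_mul_eq_lintegral_mul_lintegral_of_independent_measurableSpace
        h.countSpace_le h.sizeSpace_le h.indep (f := G.indicator k)
        (g := B.indicator fun _ => (1 : ℝ≥0∞)) (hk.indicator hG) (measurable_const.indicator hB)
      rw [lintegral_indicator hGm, lintegral_indicator_const hBm, one_mul] at hi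
      rw [← hi, ← lintegral_indicator (hGm.inter hBm)]
      refine lintegral_congr fun ω => ?_
      by_cases h1 : ω ∈ G <;> by_cases h2 : ω ∈ B <;> simp [Set.indicator, h1, h2]
    have hfin := measure_eq_of_sup (μ := μ.withDensity f) (ν := μ.withDensity g) hFN
      h.sizeSpace_le (fun G B hG hB => ?_) (hle A hA)
    · rw [withDensity_apply _ (Filtration.le _ s A hA),
        withDensity_apply _ (Filtration.le _ s A hA)] at hfin
      rw [← lintegral_const_mul _ h.measurable_param.ennreal_ofReal]
      exact hfin
    · have hm := (hFN G hG).inter (h.sizeSpace_le B hB)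
      rw [withDensity_apply _ hm, withDensity_apply _ hm, hprod f hfm G B (hcount G hG) hB,
        hprod g hgm G B (hcount G hG) hB, hNfg G hG]

end IsCompoundModel

end Compound

/-! ### Elementary estimates and generating functions -/

section Elementary

/-- The linear bound serves for domination, the quadratic one below for the vanishing of the
remainder. -/
lemma abs_one_sub_exp_neg_sub_le {x : ℝ} (hx : 0 ≤ x) : |1 - Real.exp (-x) - x| ≤ x := by
  have h1 := Real.add_one_le_exp (-x)
  have h2 : Real.exp (-x) ≤ 1 := Real.exp_le_one_iff.2 (by linarith)
  rw [abs_le]; constructor <;> linarith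

lemma abs_one_sub_exp_neg_sub_le_sq {x : ℝ} (hx : 0 ≤ x) : |1 - Real.exp (-x) - x| ≤ x ^ 2 := by
  rcases le_total x 1 with h | h
  · have := Real.abs_exp_sub_one_sub_id_le (x := -x) (by rw [abs_neg, abs_of_nonneg hx]; exact h)
    rw [neg_sq] at this
    rwa [show 1 - Real.exp (-x) - x = -(Real.exp (-x) - 1 - -x) by ring, abs_neg]
  · exact (abs_one_sub_exp_neg_sub_le hx).trans (by nlinarith)

/-- For k ≥ 1 both |z^k - 1| and |z - 1| k are at most 2k. -/
lemma abs_pow_sub_le {z : ℝ} (hz : |z| ≤ 1) (k : ℕ) : |z ^ k - 1 - (z - 1) * k| ≤ 4 * k := by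
  rcases Nat.eq_zero_or_pos k with rfl | hk
  · simp
  · have h1 : |z ^ k| ≤ 1 := by rw [abs_pow]; exact pow_le_one₀ (abs_nonneg _) hz
    have hk' : (1 : ℝ) ≤ k := by exact_mod_cast hk
    rw [abs_le] at *
    constructor <;> nlinarith

/-- The coefficients of a power series are determined by its sum. -/
lemma eq_of_hasSum_pow {a b : ℕ → ℝ} {f : ℝ → ℝ}
    (ha : ∀ z, |z| < 1 → HasSum (fun k => z ^ k * a k) (f z))
    (hb : ∀ z, |z| < 1 → HasSum (fun k => z ^ k * b k) (f z)) : a = b := by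
  have key : ∀ c : ℕ → ℝ, (∀ z, |z| < 1 → HasSum (fun k => z ^ k * c k) (f z)) →
      HasFPowerSeriesAt f (FormalMultilinearSeries.ofScalars ℝ c) 0 := by
    intro c hc
    rw [hasFPowerSeriesAt_iff]
    filter_upwards [Metric.ball_mem_nhds (0 : ℝ) one_pos] with z hz
    rw [mem_ball_zero_iff, Real.norm_eq_abs] at hz
    simpa [FormalMultilinearSeries.coeff_ofScalars] using hc z hz
  have h := (key a ha).eq_formalMultilinearSeries (key b hb)
  funext k
  simpa [FormalMultilinearSeries.coeff_ofScalars] using congrArg (fun p => p.coeff k) h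

lemma measurable_poissonMeasure_apply (B : Set ℕ) :
    Measurable fun r : ℝ≥0 => poissonMeasure r B := by
  simp only [poissonMeasure, Measure.sum_apply_of_countable, Measure.smul_apply, smul_eq_mul]
  refine Measurable.tsum fun n => Measurable.mul_const ?_ _
  fun_prop

end Elementary

/-! ### The generating function of an increment under the martingale property -/

section Watanabe

variable {Ω : Type*} {mΩ : MeasurableSpace Ω} {μ : Measure Ω} {N : ℝ≥0 → Ω → ℕ} {Θ : Ω → ℝ}

lemma measurable_filtrationWith {β : Type*} [MeasurableSpace β] {Z : ℝ≥0 → Ω → β}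
    (hZ : ∀ t, Measurable (Z t)) (hΘ : Measurable Θ) {s t : ℝ≥0} (hst : s ≤ t) :
    Measurable[filtrationWith Z Θ hZ hΘ t] (Z s) :=
  Measurable.of_comap_le ((le_iSup (fun u : Set.Iic t => MeasurableSpace.comap (Z u) inferInstance)
    ⟨s, hst⟩).trans le_sup_left)

lemma measurable_filtrationWith_param {β : Type*} [MeasurableSpace β] {Z : ℝ≥0 → Ω → β}
    (hZ : ∀ t, Measurable (Z t)) (hΘ : Measurable Θ) (t : ℝ≥0) :
    Measurable[filtrationWith Z Θ hZ hΘ t] Θ := Measurable.of_comap_le le_sup_right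

/-- The one-step remainder in the expansion of the generating function. -/
noncomputable def genRemainder (z δ θ : ℝ) (k : ℕ) : ℝ :=
  (1 - Real.exp (-((1 - z) * θ * δ)) - (1 - z) * θ * δ) + (z ^ k - 1 - (z - 1) * k)

/-- This bound is additive in δ and k, so its sum over the cells of a partition does not depend on
the partition: it is the dominating function. -/
lemma abs_genRemainder_le {z δ θ : ℝ} (hz : |z| ≤ 1) (hδ : 0 ≤ δ) (hθ : 0 ≤ θ) (k : ℕ) :
    |genRemainder z δ θ k| ≤ (1 - z) * θ * δ + 4 * k := by
  have hz' : 0 ≤ 1 - z := by linarith [(abs_le.1 hz).2]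
  exact (abs_add_le _ _).trans
    (add_le_add (abs_one_sub_exp_neg_sub_le (by positivity)) (abs_pow_sub_le hz k))

/-- The part that depends on k vanishes at k = 0 and k = 1. This is where unit jumps enter; what
remains is of second order in δ. -/
lemma abs_genRemainder_le_sq {z δ θ : ℝ} (hz : |z| ≤ 1) (hδ : 0 ≤ δ) (hθ : 0 ≤ θ) {k : ℕ}
    (hk : k ≤ 1) : |genRemainder z δ θ k| ≤ ((1 - z) * θ * δ) ^ 2 := by
  have hz' : 0 ≤ 1 - z := by linarith [(abs_le.1 hz).2]
  have h0 : z ^ k - 1 - (z - 1) * k = 0 := by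
    interval_cases k <;> simp
  rw [genRemainder, h0, add_zero]
  exact abs_one_sub_exp_neg_sub_le_sq (by positivity)

/-- The conditional generating function of the increments of a counting process with
intensity `Θ` is that of the Poisson distribution. -/
lemma setIntegral_pow_increment [IsProbabilityMeasure μ] (hN : IsCountingProcess N)
    (hΘ : Measurable Θ) (hΘint : Integrable Θ μ) (hΘ0 : 0 ≤ᵐ[μ] Θ)
    (hM : Martingale (fun (t : ℝ≥0) ω => (N t ω : ℝ) - t * Θ ω)
      (filtrationWith N Θ hN.measurable hΘ) μ)
    {s t : ℝ≥0} (hst : s ≤ t) {A : Set Ω}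
    (hA : MeasurableSet[filtrationWith N Θ hN.measurable hΘ s] A) {z : ℝ} (hz : |z| ≤ 1) :
    ∫ ω in A, z ^ (N t ω - N s ω) ∂μ
      = ∫ ω in A, Real.exp (-((1 - z) * Θ ω * (t - s))) ∂μ := by
  set ℱ := filtrationWith N Θ hN.measurable hΘ with hℱ
  have hAm : MeasurableSet A := ℱ.le s A hA
  have hz' : 0 ≤ 1 - z := by linarith [(abs_le.1 hz).2]
  set p := partPoint s t with hp
  have hps : ∀ n i, s ≤ p n i := fun n i => le_partPoint s t n i
  set δ : ℕ → ℝ := fun n => ((t : ℝ) - s) / (n + 1) with hδ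
  have hts : (0 : ℝ) ≤ t - s := sub_nonneg.2 (NNReal.coe_le_coe.2 hst)
  have hδ0 : ∀ n, 0 ≤ δ n := fun n => by positivity
  have hpδ : ∀ n i, (p n (i + 1) : ℝ) = p n i + δ n := fun n i => by
    simp only [hp, partPoint_succ, hδ]
    push_cast [NNReal.coe_sub hst]
    rfl
  set M : ℝ≥0 → Ω → ℝ := fun t ω => (N t ω : ℝ) - t * Θ ω with hMdef
  -- The product of `Z` and `q` interpolates between the two integrands of the claim: at i = 0 it is
  -- the exponential, since Z = 1, and at i = n + 1 it is z^(N_t - N_s), since q = 1.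
  set q : ℕ → ℕ → Ω → ℝ := fun n i ω => Real.exp (-((1 - z) * Θ ω * (t - p n i))) with hq
  set Z : ℕ → ℕ → Ω → ℝ := fun n i ω => z ^ (N (p n i) ω - N s ω) with hZ
  -- `q` is taken at the right endpoint and `Z` at the left one. The weight is still known at the
  -- left endpoint, because `q` depends on `Θ` alone and `Θ` is known at time 0.
  set ξ : ℕ → ℕ → Ω → ℝ := fun n i => A.indicator fun ω => q n (i + 1) ω * Z n i ω with hξ
  set R : ℕ → Ω → ℝ := fun n ω => ∑ i ∈ Finset.range (n + 1),
    ξ n i ω * genRemainder z (δ n) (Θ ω) (N (p n (i + 1)) ω - N (p n i) ω) with hR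
  have hNr : ∀ u v, u ≤ v → Measurable[ℱ v] (N u) := fun u v huv =>
    measurable_filtrationWith hN.measurable hΘ huv
  have hΘr : ∀ u, Measurable[ℱ u] Θ := fun u =>
    measurable_filtrationWith_param hN.measurable hΘ u
  have hqm : ∀ n i u, Measurable[ℱ u] (q n i) := fun n i u =>
    Real.measurable_exp.comp (((hΘr u).const_mul _).mul_const _).neg
  have hZm : ∀ n i, Measurable[ℱ (p n i)] (Z n i) := fun n i =>
    (measurable_from_top (f := fun k : ℕ => z ^ k)).comp
      ((hNr _ _ le_rfl).sub (hNr _ _ (hps n i)))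
  have hξm : ∀ n i, Measurable[ℱ (p n i)] (ξ n i) := fun n i =>
    ((hqm n (i + 1) _).mul (hZm n i)).indicator (ℱ.mono (hps n i) A hA)
  have hq1 : ∀ n i, i ≤ n + 1 → ∀ ω, 0 ≤ Θ ω → |q n i ω| ≤ 1 := by
    intro n i hi ω hω
    rw [abs_of_pos (Real.exp_pos _)]
    refine Real.exp_le_one_iff.2 (neg_nonpos.2 ?_)
    have : (p n i : ℝ) ≤ t := NNReal.coe_le_coe.2 (partPoint_le hst hi)
    have h1 := sub_nonneg.2 this
    positivity
  have hZ1 : ∀ n i ω, |Z n i ω| ≤ 1 := fun n i ω => by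
    simp only [hZ, abs_pow]; exact pow_le_one₀ (abs_nonneg _) hz
  have hξ1 : ∀ n i, i ≤ n → ∀ ω, 0 ≤ Θ ω → |ξ n i ω| ≤ 1 := by
    intro n i hi ω hω
    simp only [hξ, Set.indicator]
    split_ifs
    · rw [abs_mul]
      exact mul_le_one₀ (hq1 n _ (by omega) ω hω) (abs_nonneg _) (hZ1 n i ω)
    · simp
  have hξM : ∀ n i, i ≤ n → ∫ ω, ξ n i ω * (M (p n (i + 1)) ω - M (p n i) ω) ∂μ = 0 := by
    intro n i hi
    have hb : ∀ᵐ ω ∂μ, ‖ξ n i ω‖ ≤ 1 := by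
      filter_upwards [hΘ0] with ω hω using hξ1 n i hi ω hω
    have hξas : AEStronglyMeasurable (ξ n i) μ :=
      ((hξm n i).mono (ℱ.le _) le_rfl).aestronglyMeasurable
    have h1 := integral_mul_increment_eq hM (partPoint_mono s t n (Nat.le_succ i)) (hξm n i) hb
    simp only [mul_sub]
    rw [integral_sub ((hM.integrable _).bdd_mul hξas hb) ((hM.integrable _).bdd_mul hξas hb)]
    exact sub_eq_zero.2 h1
  have hξMint : ∀ n i, i ≤ n →
      Integrable (fun ω => ξ n i ω * (M (p n (i + 1)) ω - M (p n i) ω)) μ := by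
    intro n i hi
    have hb : ∀ᵐ ω ∂μ, ‖ξ n i ω‖ ≤ 1 := by
      filter_upwards [hΘ0] with ω hω using hξ1 n i hi ω hω
    exact ((hM.integrable _).sub (hM.integrable _)).bdd_mul
      ((hξm n i).mono (ℱ.le _) le_rfl).aestronglyMeasurable hb
  set g : Ω → ℝ := A.indicator fun ω => z ^ (N t ω - N s ω) with hg
  set g₀ : Ω → ℝ := A.indicator fun ω => Real.exp (-((1 - z) * Θ ω * (t - s))) with hg₀
  -- With k the increment of `N` over a cell, z^k - exp(-(1-z)Θδ) is the remainder minus (1-z)(k -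
  -- Θδ), and k - Θδ is the increment of the martingale. Summing the telescoping products gives the
  -- identity.
  have htele : ∀ n ω, R n ω = (g ω - g₀ ω)
      + (1 - z) * ∑ i ∈ Finset.range (n + 1), ξ n i ω * (M (p n (i + 1)) ω - M (p n i) ω) := by
    intro n ω
    by_cases hω : ω ∈ A
    swap
    · simp [hR, hξ, hg, hg₀, hω]
    have hgg : g ω - g₀ ω = ∑ i ∈ Finset.range (n + 1),
        (Z n (i + 1) ω * q n (i + 1) ω - Z n i ω * q n i ω) := by
      rw [Finset.sum_range_sub (fun i => Z n i ω * q n i ω)]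
      simp [hg, hg₀, hω, hZ, hq, hp, partPoint_last hst, partPoint_zero]
    rw [hgg, Finset.mul_sum, ← Finset.sum_add_distrib]
    refine Finset.sum_congr rfl fun i _ => ?_
    have h1 := hN.monotone ω (partPoint_mono s t n (Nat.le_succ i))
    have h2 := hN.monotone ω (hps n i)
    simp only [Nat.succ_eq_add_one] at h1 h2
    have eZ : Z n (i + 1) ω = Z n i ω * z ^ (N (p n (i + 1)) ω - N (p n i) ω) := by
      simp only [hZ, ← pow_add]
      congr 1
      simp only [hp] at h2 ⊢
      omega
    have eq' : q n i ω = q n (i + 1) ω * Real.exp (-((1 - z) * Θ ω * δ n)) := by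
      simp only [hq, ← Real.exp_add, hpδ]
      congr 1; ring
    have eM : M (p n (i + 1)) ω - M (p n i) ω
        = ((N (p n (i + 1)) ω - N (p n i) ω : ℕ) : ℝ) - δ n * Θ ω := by
      simp only [hMdef, hpδ]
      rw [Nat.cast_sub h1]
      ring
    have eξ : ξ n i ω = q n (i + 1) ω * Z n i ω := by simp [hξ, hω]
    rw [eM, eZ, eq', eξ, genRemainder]
    ring
  have hgint : Integrable g μ := by
    refine Integrable.indicator (Integrable.of_bound (C := 1) ?_ (Eventually.of_forall fun ω => ?_))
      hAm
    · exact ((measurable_from_top (f := fun k : ℕ => z ^ k)).comp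
        ((hN.measurable t).sub (hN.measurable s))).aestronglyMeasurable
    · rw [Real.norm_eq_abs, abs_pow]; exact pow_le_one₀ (abs_nonneg _) hz
  have hg₀int : Integrable g₀ μ := by
    refine Integrable.indicator (Integrable.of_bound (C := 1) ?_ ?_) hAm
    · exact (Real.measurable_exp.comp ((hΘ.const_mul _).mul_const _).neg).aestronglyMeasurable
    · filter_upwards [hΘ0] with ω hω
      simp only [Pi.zero_apply] at hω
      rw [Real.norm_eq_abs, abs_of_pos (Real.exp_pos _)]
      exact Real.exp_le_one_iff.2 (neg_nonpos.2 (by positivity))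
  -- The martingale terms integrate to 0, so this integral does not depend on n; it remains to see
  -- that it tends to 0.
  have hRint : ∀ n, ∫ ω, R n ω ∂μ = ∫ ω, (g ω - g₀ ω) ∂μ := by
    intro n
    have hz0 : ∫ ω, ∑ i ∈ Finset.range (n + 1),
        ξ n i ω * (M (p n (i + 1)) ω - M (p n i) ω) ∂μ = 0 := by
      rw [integral_finsetSum _ fun i hi => hξMint n i (Nat.lt_succ_iff.1 (Finset.mem_range.1 hi))]
      exact Finset.sum_eq_zero fun i hi => hξM n i (Nat.lt_succ_iff.1 (Finset.mem_range.1 hi))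
    simp only [htele n]
    rw [integral_add (f := fun ω => g ω - g₀ ω) (hgint.sub hg₀int), integral_const_mul, hz0,
      mul_zero, add_zero]
    exact (integrable_finsetSum _ fun i hi =>
      hξMint n i (Nat.lt_succ_iff.1 (Finset.mem_range.1 hi))).const_mul _
  have hNint : ∀ u, Integrable (fun ω => (N u ω : ℝ)) μ := fun u => by
    refine ((hM.integrable u).add (hΘint.const_mul (u : ℝ))).congr
      (Eventually.of_forall fun ω => ?_)
    simp [hMdef]
  have hlim : Tendsto (fun n => ∫ ω, R n ω ∂μ) atTop (𝓝 (∫ _, (0 : ℝ) ∂μ)) := by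
    refine tendsto_integral_of_dominated_convergence
      (fun ω => (1 - z) * Θ ω * (t - s) + 4 * ((N t ω : ℝ) - N s ω)) (fun n => ?_) ?_
      (fun n => ?_) ?_
    · have h1 : Measurable (R n) := by
        have h2 : R n = fun ω => (g ω - g₀ ω) + (1 - z) * ∑ i ∈ Finset.range (n + 1),
            ξ n i ω * (M (p n (i + 1)) ω - M (p n i) ω) := funext (htele n)
        have hMm : ∀ u, Measurable (M u) := fun u =>
          ((measurable_from_top (f := fun k : ℕ => (k : ℝ))).comp (hN.measurable u)).sub
            (hΘ.const_mul _)
        rw [h2]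
        refine Measurable.add (Measurable.sub (Measurable.indicator ?_ hAm)
          (Measurable.indicator ?_ hAm)) (Measurable.const_mul
            (Finset.measurable_sum _ fun i _ => Measurable.mul ?_ ((hMm _).sub (hMm _))) _)
        · exact (measurable_from_top (f := fun k : ℕ => z ^ k)).comp
            ((hN.measurable t).sub (hN.measurable s))
        · exact Real.measurable_exp.comp ((hΘ.const_mul _).mul_const _).neg
        · exact (hξm n i).mono (ℱ.le _) le_rfl
      exact h1.aestronglyMeasurable
    · exact ((hΘint.const_mul _).mul_const _).add (((hNint t).sub (hNint s)).const_mul 4)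
    · filter_upwards [hΘ0] with ω hω
      calc ‖R n ω‖ ≤ ∑ i ∈ Finset.range (n + 1), ((1 - z) * Θ ω * δ n
              + 4 * ((N (p n (i + 1)) ω : ℝ) - N (p n i) ω)) := by
            refine norm_sum_le_of_le _ fun i hi => ?_
            have hi' := Nat.lt_succ_iff.1 (Finset.mem_range.1 hi)
            have h1 := hN.monotone ω (partPoint_mono s t n (Nat.le_succ i))
            rw [norm_mul]
            refine (mul_le_of_le_one_left (norm_nonneg _) (hξ1 n i hi' ω hω)).trans ?_
            have := abs_genRemainder_le hz (hδ0 n) hω (N (p n (i + 1)) ω - N (p n i) ω)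
            rwa [Nat.cast_sub h1] at this
        _ = (1 - z) * Θ ω * (t - s) + 4 * ((N t ω : ℝ) - N s ω) := by
            rw [Finset.sum_add_distrib, ← Finset.mul_sum, ← Finset.mul_sum,
              Finset.sum_range_sub (fun i => (N (p n i) ω : ℝ))]
            simp only [hp, partPoint_last hst, partPoint_zero, Finset.sum_const, Finset.card_range,
              nsmul_eq_mul, hδ]
            push_cast
            field_simp
    · filter_upwards [hΘ0] with ω hω
      have hsq : Tendsto (fun n : ℕ => ((1 - z) * Θ ω * (t - s)) ^ 2 / ((n : ℝ) + 1)) atTop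
          (𝓝 0) := by
        have := (tendsto_const_div_atTop_nhds_zero_nat
          (((1 - z) * Θ ω * (t - s)) ^ 2)).comp (tendsto_add_atTop_nat 1)
        refine this.congr fun n => ?_
        simp
      refine squeeze_zero_norm' ?_ hsq
      -- Eventually each of the n + 1 cells holds at most one jump and contributes at most a square
      -- of order 1/(n+1)².
      filter_upwards [hN.eventually_jump_le_one ω hst] with n hn
      calc ‖R n ω‖ ≤ ∑ i ∈ Finset.range (n + 1), ((1 - z) * Θ ω * δ n) ^ 2 := by
            refine norm_sum_le_of_le _ fun i hi => ?_
            have hi' := Nat.lt_succ_iff.1 (Finset.mem_range.1 hi)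
            rw [norm_mul]
            refine (mul_le_of_le_one_left (norm_nonneg _) (hξ1 n i hi' ω hω)).trans ?_
            refine abs_genRemainder_le_sq hz (hδ0 n) hω ?_
            have := hn i hi'
            simp only [hp]
            omega
        _ = ((1 - z) * Θ ω * (t - s)) ^ 2 / ((n : ℝ) + 1) := by
            simp only [Finset.sum_const, Finset.card_range, nsmul_eq_mul, hδ]
            push_cast
            field_simp
  simp only [hRint, integral_zero] at hlim
  have h0 := tendsto_nhds_unique hlim tendsto_const_nhds
  rw [integral_sub hgint hg₀int, hg, hg₀, integral_indicator hAm, integral_indicator hAm] at h0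
  linarith

end Watanabe

/-! ### From generating functions to the Poisson law of an increment -/

section ConditionalLaw

variable {Ω : Type*} {mΩ : MeasurableSpace Ω} {μ : Measure Ω} {N : ℝ≥0 → Ω → ℕ} {Θ : Ω → ℝ}

/-- The geometric series of |z| dominates, so sum and integral can be exchanged. This turns an
integrated generating function into the generating function of the integrated probabilities. -/
lemma hasSum_pow_mul_integral [IsFiniteMeasure μ] {F : ℕ → Ω → ℝ} {G : Ω → ℝ} {z : ℝ}
    (hz : |z| < 1) (hF : ∀ k, Measurable (F k)) (hF0 : ∀ k ω, 0 ≤ F k ω) (hF1 : ∀ k ω, F k ω ≤ 1)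
    (hG : ∀ᵐ ω ∂μ, HasSum (fun k => z ^ k * F k ω) (G ω)) :
    HasSum (fun k => z ^ k * ∫ ω, F k ω ∂μ) (∫ ω, G ω ∂μ) := by
  have hint : ∀ k, Integrable (F k) μ := fun k =>
    Integrable.of_bound (C := 1) (hF k).aestronglyMeasurable (Eventually.of_forall fun ω => by
      rw [Real.norm_eq_abs, abs_of_nonneg (hF0 k ω)]; exact hF1 k ω)
  have hsum : Summable fun k => ∫ ω, ‖z ^ k * F k ω‖ ∂μ := by
    refine Summable.of_nonneg_of_le (fun k => integral_nonneg fun ω => norm_nonneg _) (fun k => ?_)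
      ((summable_geometric_of_lt_one (abs_nonneg z) hz).mul_right (μ.real Set.univ))
    calc ∫ ω, ‖z ^ k * F k ω‖ ∂μ ≤ ∫ _, |z| ^ k ∂μ := by
          refine integral_mono ((hint k).const_mul _).norm (integrable_const _) fun ω => ?_
          simp only [norm_mul, norm_pow, Real.norm_eq_abs, abs_of_nonneg (hF0 k ω)]
          exact mul_le_of_le_one_right (by positivity) (hF1 k ω)
      _ = _ := by simp [mul_comm]
  have := hasSum_integral_of_summable_integral_norm (F := fun k ω => z ^ k * F k ω)
    (fun k => (hint k).const_mul (z ^ k)) hsum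
  simp only [integral_const_mul] at this
  have hG' : ∫ ω, G ω ∂μ = ∫ ω, ∑' k, z ^ k * F k ω ∂μ := integral_congr_ae <| by
    filter_upwards [hG] with ω hω using hω.tsum_eq.symm
  rwa [hG']

lemma hasSum_poisson_pow (r : ℝ≥0) (z : ℝ) :
    HasSum (fun k => z ^ k * (poissonMeasure r).real {k}) (Real.exp (-((1 - z) * r))) := by
  have h := (NormedSpace.expSeries_div_hasSum_exp (𝔸 := ℝ) (z * r)).mul_left (Real.exp (-r))
  rw [← Real.exp_eq_exp_ℝ, ← Real.exp_add] at h
  have e1 : (fun k => z ^ k * (poissonMeasure r).real {k})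
      = fun k => Real.exp (-r) * ((z * r) ^ k / k.factorial) := by
    funext k
    rw [poissonMeasure_real_singleton, mul_pow]
    ring
  rw [e1, show -((1 - z) * (r : ℝ)) = -r + z * r by ring]
  exact h

/-- **Watanabe's theorem**: given the past, the increments of a counting process with
intensity `Θ` follow the Poisson distribution. -/
lemma measure_increment_eq [IsProbabilityMeasure μ] (hN : IsCountingProcess N)
    (hΘ : Measurable Θ) (hΘint : Integrable Θ μ) (hΘ0 : 0 ≤ᵐ[μ] Θ)
    (hM : Martingale (fun (t : ℝ≥0) ω => (N t ω : ℝ) - t * Θ ω)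
      (filtrationWith N Θ hN.measurable hΘ) μ)
    {s t : ℝ≥0} (hst : s ≤ t) {A : Set Ω}
    (hA : MeasurableSet[filtrationWith N Θ hN.measurable hΘ s] A) (B : Set ℕ) :
    μ (A ∩ {ω | N t ω - N s ω ∈ B})
      = ∫⁻ ω in A, poissonMeasure ((t - s) * (Θ ω).toNNReal) B ∂μ := by
  have hAm : MeasurableSet A := Filtration.le _ s A hA
  have hD : Measurable fun ω => N t ω - N s ω := (hN.measurable t).sub (hN.measurable s)
  have hr : Measurable fun ω => (t - s) * (Θ ω).toNNReal := hΘ.real_toNNReal.const_mul _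
  have hpm : ∀ B, Measurable fun ω => poissonMeasure ((t - s) * (Θ ω).toNNReal) B := fun B =>
    (measurable_poissonMeasure_apply B).comp hr
  -- Both sequences are coefficients of the same power series on |z| < 1, by
  -- `setIntegral_pow_increment`.
  have hreal : (fun k : ℕ => ∫ ω in A, (if N t ω - N s ω = k then (1 : ℝ) else 0) ∂μ)
      = fun k : ℕ => ∫ ω in A, (poissonMeasure ((t - s) * (Θ ω).toNNReal)).real {k} ∂μ := by
    refine eq_of_hasSum_pow (f := fun z => ∫ ω in A, z ^ (N t ω - N s ω) ∂μ)
      (fun z hz => ?_) fun z hz => ?_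
    · refine hasSum_pow_mul_integral hz (fun k => ?_) (fun k ω => ?_) (fun k ω => ?_)
        (Eventually.of_forall fun ω => ?_)
      · exact Measurable.ite (hD (measurableSet_singleton k)) measurable_const measurable_const
      · split_ifs <;> norm_num
      · split_ifs <;> norm_num
      · convert hasSum_ite_eq (N t ω - N s ω) (z ^ (N t ω - N s ω)) using 2 with k
        by_cases hk : N t ω - N s ω = k
        · simp [hk]
        · simp [hk, Ne.symm hk]
    · rw [setIntegral_pow_increment hN hΘ hΘint hΘ0 hM hst hA hz.le]
      refine hasSum_pow_mul_integral hz (fun k => (hpm {k}).ennreal_toReal)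
        (fun k ω => measureReal_nonneg) (fun k ω => measureReal_le_one) ?_
      filter_upwards [ae_restrict_of_ae hΘ0] with ω hω
      convert hasSum_poisson_pow ((t - s) * (Θ ω).toNNReal) z using 2
      simp only [NNReal.coe_mul, NNReal.coe_sub hst, Real.coe_toNNReal _ hω]
      ring
  have hsing : ∀ k : ℕ, μ (A ∩ {ω | N t ω - N s ω = k})
      = ∫⁻ ω in A, poissonMeasure ((t - s) * (Θ ω).toNNReal) {k} ∂μ := by
    intro k
    have h1 := congrFun hreal k
    simp only [measureReal_def] at h1
    rw [integral_toReal (hpm {k}).aemeasurable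
      (Eventually.of_forall fun ω => measure_lt_top _ _)] at h1
    have h2 : ∫ ω in A, (if N t ω - N s ω = k then (1 : ℝ) else 0) ∂μ
        = (μ (A ∩ {ω | N t ω - N s ω = k})).toReal := by
      have : (fun ω => if N t ω - N s ω = k then (1 : ℝ) else 0)
          = {ω | N t ω - N s ω = k}.indicator 1 := by
        funext ω; simp [Set.indicator]
      have hm : MeasurableSet {ω | N t ω - N s ω = k} := hD (measurableSet_singleton k)
      rw [this, integral_indicator_one hm, measureReal_def, Measure.restrict_apply hm,
        Set.inter_comm]
    rw [h2] at h1
    refine (ENNReal.toReal_eq_toReal_iff' (measure_ne_top _ _) (ne_of_lt ?_)).1 h1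
    calc _ ≤ ∫⁻ _ in A, 1 ∂μ := lintegral_mono fun ω => prob_le_one
      _ < ∞ := by simp [measure_lt_top]
  have hB : ∀ (ν : Measure ℕ), ν B = ∑' k : B, ν {(k : ℕ)} := fun ν => by
    conv_lhs => rw [← Set.biUnion_of_singleton B]
    exact measure_biUnion (Set.to_countable B) (fun i _ j _ hij => Set.disjoint_singleton.2 hij)
      fun _ _ => measurableSet_singleton _
  have hL := hB ((μ.restrict A).map fun ω => N t ω - N s ω)
  rw [Measure.map_apply hD (MeasurableSet.of_discrete), Measure.restrict_apply
    (hD MeasurableSet.of_discrete), Set.inter_comm] at hL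
  have hset : {ω | N t ω - N s ω ∈ B} = (fun ω => N t ω - N s ω) ⁻¹' B := rfl
  rw [hset, hL]
  simp only [hB (poissonMeasure _)]
  rw [lintegral_tsum fun k => (hpm _).aemeasurable]
  refine tsum_congr fun k => ?_
  rw [← hsing, Measure.map_apply hD (measurableSet_singleton _), Measure.restrict_apply
    (hD (measurableSet_singleton _)), Set.inter_comm]
  rfl

end ConditionalLaw

/-! ### Reduction of the intensity identity to countably many grid steps and cylinders -/

section Grid

variable {Ω : Type*} {mΩ : MeasurableSpace Ω} {μ : Measure Ω} {N : ℝ≥0 → Ω → ℕ} {Θ : Ω → ℝ}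

/-- The event that `N` satisfies the finitely many constraints `N_u = k`, `(u, k) ∈ J`. -/
def cylinder (N : ℝ≥0 → Ω → ℕ) (J : Finset (ℝ≥0 × ℕ)) : Set Ω := {ω | ∀ p ∈ J, N p.1 ω = p.2}

lemma measurableSet_cylinder {m : MeasurableSpace Ω} {J : Finset (ℝ≥0 × ℕ)}
    (hN : ∀ p ∈ J, Measurable[m] (N p.1)) : MeasurableSet[m] (cylinder N J) := by
  have : cylinder N J = ⋂ p ∈ J, N p.1 ⁻¹' {p.2} := by ext; simp [cylinder]
  rw [this]
  exact Finset.measurableSet_biInter _ fun p hp => hN p hp (measurableSet_singleton _)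

/-- The intensity identity for the steps of the grids `{i / (n + 1)}` and for cylinder events. -/
def HasGridIntensity (μ : Measure Ω) (N : ℝ≥0 → Ω → ℕ) (Θ : Ω → ℝ) : Prop :=
  ∀ (n i : ℕ) (J : Finset (ℕ × ℕ)), (∀ p ∈ J, p.1 ≤ i) → ∀ F : Set ℝ, MeasurableSet F →
    ∫⁻ ω in Θ ⁻¹' F ∩ {ω | ∀ p ∈ J, N (gridPoint n p.1) ω = p.2},
        ENNReal.ofReal ((N (gridPoint n (i + 1)) ω : ℝ) - N (gridPoint n i) ω) ∂μ
      = ENNReal.ofReal (1 / ((n : ℝ) + 1)) *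
        ∫⁻ ω in Θ ⁻¹' F ∩ {ω | ∀ p ∈ J, N (gridPoint n p.1) ω = p.2}, ENNReal.ofReal (Θ ω) ∂μ

lemma HasIntensity.grid (hN : IsCountingProcess N) (hΘ : Measurable Θ)
    (h : HasIntensity μ (filtrationWith N Θ hN.measurable hΘ) (fun t ω => (N t ω : ℝ)) Θ) :
    HasGridIntensity μ N Θ := by
  intro n i J hJ F hF
  have hm : MeasurableSet[filtrationWith N Θ hN.measurable hΘ (gridPoint n i)]
      (Θ ⁻¹' F ∩ {ω | ∀ p ∈ J, N (gridPoint n p.1) ω = p.2}) := by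
    refine MeasurableSet.inter (measurable_filtrationWith_param hN.measurable hΘ _ hF) ?_
    have : {ω | ∀ p ∈ J, N (gridPoint n p.1) ω = p.2}
        = ⋂ p ∈ J, N (gridPoint n p.1) ⁻¹' {p.2} := by ext; simp
    rw [this]
    exact Finset.measurableSet_biInter _ fun p hp =>
      measurable_filtrationWith hN.measurable hΘ (gridPoint_mono n (hJ p hp))
        (measurableSet_singleton _)
  have := h _ _ (gridPoint_mono n (Nat.le_succ i)) _ hm
  rw [this]
  congr 2
  simp only [gridPoint]
  push_cast
  ring

namespace HasGridIntensity

variable (h : HasGridIntensity μ N Θ) (hN : IsCountingProcess N)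
include h hN

/-- The steps between i and j are added up. A cylinder fixed by index i is also admissible at each
later step, so the event stays the same throughout. -/
lemma of_le (n : ℕ) {i j : ℕ} (hij : i ≤ j) (J : Finset (ℕ × ℕ)) (hJ : ∀ p ∈ J, p.1 ≤ i)
    {F : Set ℝ} (hF : MeasurableSet F) :
    ∫⁻ ω in Θ ⁻¹' F ∩ {ω | ∀ p ∈ J, N (gridPoint n p.1) ω = p.2},
        ENNReal.ofReal ((N (gridPoint n j) ω : ℝ) - N (gridPoint n i) ω) ∂μ
      = ENNReal.ofReal ((gridPoint n j : ℝ) - gridPoint n i) *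
        ∫⁻ ω in Θ ⁻¹' F ∩ {ω | ∀ p ∈ J, N (gridPoint n p.1) ω = p.2},
          ENNReal.ofReal (Θ ω) ∂μ := by
  have hmono : ∀ ω {k l : ℕ}, k ≤ l →
      (N (gridPoint n k) ω : ℝ) ≤ N (gridPoint n l) ω := fun ω k l hkl =>
    Nat.cast_le.2 (hN.monotone ω (gridPoint_mono n hkl))
  have hNm : ∀ k, Measurable fun ω => (N (gridPoint n k) ω : ℝ) := fun k =>
    (measurable_from_top (f := fun k : ℕ => (k : ℝ))).comp (hN.measurable _)
  induction j, hij using Nat.le_induction with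
  | base => simp
  | succ j hij ih =>
    have e1 : ∀ ω, ENNReal.ofReal ((N (gridPoint n (j + 1)) ω : ℝ) - N (gridPoint n i) ω)
        = ENNReal.ofReal ((N (gridPoint n j) ω : ℝ) - N (gridPoint n i) ω)
          + ENNReal.ofReal ((N (gridPoint n (j + 1)) ω : ℝ) - N (gridPoint n j) ω) := fun ω => by
      rw [← ENNReal.ofReal_add (sub_nonneg.2 (hmono ω hij)) (sub_nonneg.2 (hmono ω j.le_succ))]
      congr 1; ring
    have e2 : (gridPoint n (j + 1) : ℝ) - gridPoint n i
        = ((gridPoint n j : ℝ) - gridPoint n i) + 1 / ((n : ℝ) + 1) := by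
      simp only [gridPoint]; push_cast; ring
    simp only [e1]
    have hm : Measurable fun ω =>
        ENNReal.ofReal ((N (gridPoint n j) ω : ℝ) - N (gridPoint n i) ω) :=
      ((hNm j).sub (hNm i)).ennreal_ofReal
    rw [lintegral_add_left hm, ih,
      h n j J (fun p hp => (hJ p hp).trans hij) F hF, e2, ENNReal.ofReal_add _ (by positivity),
      add_mul]
    exact sub_nonneg.2 (NNReal.coe_le_coe.2 (gridPoint_mono n hij))

/-- The grid with n = 0 consists of the integers. The resulting finite mean provides the dominating
function when grid times decrease to real times. -/
lemma lintegral_lt_top (hΘint : Integrable Θ μ) (K : ℕ) :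
    ∫⁻ ω, ENNReal.ofReal (N K ω) ∂μ < ∞ := by
  have := h.of_le hN 0 (Nat.zero_le K) ∅ (by simp) MeasurableSet.univ
  simp only [gridPoint, CharP.cast_eq_zero, zero_add, div_one, hN.zero,
    sub_zero, Set.preimage_univ, Finset.notMem_empty, IsEmpty.forall_iff, implies_true,
    Set.ofPred_true, Set.univ_inter, Measure.restrict_univ] at this
  rw [this]
  refine ENNReal.mul_lt_top ENNReal.ofReal_lt_top ?_
  exact lt_of_le_of_lt (lintegral_mono fun ω => Real.ofReal_le_enorm (Θ ω)) hΘint.2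

/-- Right continuity extends the intensity identity from the grids to arbitrary times. -/
lemma cylinder_eq (hΘ : Measurable Θ) (hΘint : Integrable Θ μ) {s t : ℝ≥0} (hst : s ≤ t)
    {J : Finset (ℝ≥0 × ℕ)} (hJ : ∀ p ∈ J, p.1 ≤ s) {F : Set ℝ} (hF : MeasurableSet F) :
    ∫⁻ ω in Θ ⁻¹' F ∩ cylinder N J, ENNReal.ofReal ((N t ω : ℝ) - N s ω) ∂μ
      = ENNReal.ofReal (t - s) * ∫⁻ ω in Θ ⁻¹' F ∩ cylinder N J, ENNReal.ofReal (Θ ω) ∂μ := by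
  -- All times, those of the cylinder included, are rounded up to the grid. Rounding is monotone, so
  -- the cylinder times stay below the rounded s.
  set r : ℕ → ℝ≥0 → ℝ≥0 := fun n x => gridPoint n (gridNum n x) with hr
  set Jn : ℕ → Finset (ℕ × ℕ) := fun n => J.image fun p => (gridNum n p.1, p.2) with hJn
  set E : ℕ → Set Ω := fun n =>
    Θ ⁻¹' F ∩ {ω | ∀ p ∈ Jn n, N (gridPoint n p.1) ω = p.2} with hE
  have hEmem : ∀ n ω, ω ∈ E n ↔ Θ ω ∈ F ∧ ∀ p ∈ J, N (r n p.1) ω = p.2 := by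
    intro n ω
    simp only [hE, hJn, hr, Set.mem_inter_iff, Set.mem_preimage, Set.mem_ofPred_eq,
      Finset.forall_mem_image]
  have hEm : ∀ n, MeasurableSet (E n) := fun n => by
    refine (hΘ hF).inter ?_
    have : {ω | ∀ p ∈ Jn n, N (gridPoint n p.1) ω = p.2}
        = ⋂ p ∈ Jn n, N (gridPoint n p.1) ⁻¹' {p.2} := by ext; simp
    rw [this]
    exact Finset.measurableSet_biInter _ fun p _ => hN.measurable _ (measurableSet_singleton _)
  have hEm' : MeasurableSet (Θ ⁻¹' F ∩ cylinder N J) :=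
    (hΘ hF).inter (measurableSet_cylinder fun p _ => hN.measurable _)
  have hev : ∀ ω, ∀ᶠ n in atTop, (ω ∈ E n ↔ ω ∈ Θ ⁻¹' F ∩ cylinder N J) ∧
      N (r n t) ω = N t ω ∧ N (r n s) ω = N s ω := by
    intro ω
    have h1 : ∀ᶠ n in atTop, ∀ p ∈ J, N (r n p.1) ω = N p.1 ω :=
      (Finset.eventually_all J).2 fun p _ => hN.eventually_gridPoint ω p.1
    filter_upwards [h1, hN.eventually_gridPoint ω t, hN.eventually_gridPoint ω s] with n h1 h2 h3
    refine ⟨?_, h2, h3⟩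
    rw [hEmem]
    refine and_congr Iff.rfl ?_
    exact forall₂_congr fun p hp => by rw [h1 p hp]
  have hNm : ∀ u, Measurable fun ω => (N u ω : ℝ) := fun u =>
    (measurable_from_top (f := fun k : ℕ => (k : ℝ))).comp (hN.measurable _)
  obtain ⟨K, hK⟩ := exists_nat_ge (t + 1)
  have hgrid : ∀ n, ∫⁻ ω in E n, ENNReal.ofReal ((N (r n t) ω : ℝ) - N (r n s) ω) ∂μ
      = ENNReal.ofReal ((r n t : ℝ) - r n s) * ∫⁻ ω in E n, ENNReal.ofReal (Θ ω) ∂μ := fun n =>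
    h.of_le hN n (gridNum_mono n hst) (Jn n) (by
      intro p hp
      obtain ⟨p', hp', rfl⟩ := Finset.mem_image.1 hp
      exact gridNum_mono n (hJ p' hp')) hF
  have hL : Tendsto (fun n => ∫⁻ ω in E n, ENNReal.ofReal ((N (r n t) ω : ℝ) - N (r n s) ω) ∂μ)
      atTop (𝓝 (∫⁻ ω in Θ ⁻¹' F ∩ cylinder N J, ENNReal.ofReal ((N t ω : ℝ) - N s ω) ∂μ)) := by
    simp only [← lintegral_indicator hEm', ← lintegral_indicator (hEm _)]
    refine tendsto_lintegral_of_dominated_convergence (fun ω => ENNReal.ofReal (N K ω))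
      (fun n => ((hNm _).sub (hNm _)).ennreal_ofReal.indicator (hEm n)) (fun n => ?_)
      (h.lintegral_lt_top hN hΘint K).ne ?_
    · refine Eventually.of_forall fun ω => ?_
      refine (Set.indicator_le_self _ _ ω).trans (ENNReal.ofReal_le_ofReal ?_)
      have h1 : N (r n t) ω ≤ N K ω :=
        hN.monotone ω ((gridPoint_le_add_one n t).trans hK)
      have h2 : (N (r n t) ω : ℝ) ≤ N K ω := Nat.cast_le.2 h1
      have h3 : (0 : ℝ) ≤ N (r n s) ω := Nat.cast_nonneg _
      linarith
    · refine Eventually.of_forall fun ω => tendsto_const_nhds.congr' ?_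
      filter_upwards [hev ω] with n ⟨h1, h2, h3⟩
      by_cases hω : ω ∈ Θ ⁻¹' F ∩ cylinder N J
      · rw [Set.indicator_of_mem hω, Set.indicator_of_mem (h1.2 hω), h2, h3]
      · rw [Set.indicator_of_notMem hω, Set.indicator_of_notMem (mt h1.1 hω)]
  have hR : Tendsto (fun n => ∫⁻ ω in E n, ENNReal.ofReal (Θ ω) ∂μ)
      atTop (𝓝 (∫⁻ ω in Θ ⁻¹' F ∩ cylinder N J, ENNReal.ofReal (Θ ω) ∂μ)) := by
    simp only [← lintegral_indicator hEm', ← lintegral_indicator (hEm _)]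
    refine tendsto_lintegral_of_dominated_convergence (fun ω => ENNReal.ofReal (Θ ω))
      (fun n => hΘ.ennreal_ofReal.indicator (hEm n)) (fun n => ?_) ?_ ?_
    · exact Eventually.of_forall fun ω => Set.indicator_le_self _ _ ω
    · exact (lt_of_le_of_lt (lintegral_mono fun ω => Real.ofReal_le_enorm (Θ ω)) hΘint.2).ne
    · refine Eventually.of_forall fun ω => tendsto_const_nhds.congr' ?_
      filter_upwards [hev ω] with n ⟨h1, h2, h3⟩
      by_cases hω : ω ∈ Θ ⁻¹' F ∩ cylinder N J
      · rw [Set.indicator_of_mem hω, Set.indicator_of_mem (h1.2 hω)]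
      · rw [Set.indicator_of_notMem hω, Set.indicator_of_notMem (mt h1.1 hω)]
  have hgap : Tendsto (fun n => ENNReal.ofReal ((r n t : ℝ) - r n s)) atTop
      (𝓝 (ENNReal.ofReal (t - s))) :=
    ENNReal.tendsto_ofReal ((NNReal.tendsto_coe.2 (tendsto_gridPoint t)).sub
      (NNReal.tendsto_coe.2 (tendsto_gridPoint s)))
  simp only [hgrid] at hL
  refine tendsto_nhds_unique hL (ENNReal.Tendsto.mul hgap (Or.inr ?_) hR
    (Or.inr ENNReal.ofReal_ne_top))
  refine ne_of_lt (lt_of_le_of_lt (setLIntegral_le_lintegral _ _) ?_)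
  exact lt_of_le_of_lt (lintegral_mono fun ω => Real.ofReal_le_enorm (Θ ω)) hΘint.2

/-- The identity is an equality of two finite measures, with densities N_t - N_s and (t - s) Θ. They
agree on cylinders up to time s intersected with events of `Θ`. The cylinders form a π-system
(constraints are united) that generates the past of `N`. -/
lemma hasIntensity (hΘ : Measurable Θ) (hΘint : Integrable Θ μ) :
    HasIntensity μ (filtrationWith N Θ hN.measurable hΘ) (fun t ω => (N t ω : ℝ)) Θ := by
  intro s t hst A hA
  have hNm : ∀ u, Measurable fun ω => (N u ω : ℝ) := fun u =>
    (measurable_from_top (f := fun k : ℕ => (k : ℝ))).comp (hN.measurable _)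
  set f : Ω → ℝ≥0∞ := fun ω => ENNReal.ofReal ((N t ω : ℝ) - N s ω) with hf
  set g : Ω → ℝ≥0∞ := fun ω => ENNReal.ofReal (t - s) * ENNReal.ofReal (Θ ω) with hg
  have hgfin : ∫⁻ ω, g ω ∂μ ≠ ∞ := by
    rw [lintegral_const_mul _ hΘ.ennreal_ofReal]
    refine ENNReal.mul_ne_top ENNReal.ofReal_ne_top (ne_of_lt ?_)
    exact lt_of_le_of_lt (lintegral_mono fun ω => Real.ofReal_le_enorm (Θ ω)) hΘint.2
  have hcyl : ∀ J : Finset (ℝ≥0 × ℕ), (∀ p ∈ J, p.1 ≤ s) → ∀ F, MeasurableSet F →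
      ∫⁻ ω in Θ ⁻¹' F ∩ cylinder N J, f ω ∂μ = ∫⁻ ω in Θ ⁻¹' F ∩ cylinder N J, g ω ∂μ := by
    intro J hJ F hF
    rw [lintegral_const_mul _ hΘ.ennreal_ofReal]
    exact h.cylinder_eq hN hΘ hΘint hst hJ hF
  have hffin : ∫⁻ ω, f ω ∂μ ≠ ∞ := by
    have := hcyl ∅ (by simp) Set.univ MeasurableSet.univ
    simp only [cylinder, Set.preimage_univ, Finset.notMem_empty, IsEmpty.forall_iff, implies_true,
      Set.ofPred_true, Set.univ_inter, Measure.restrict_univ] at this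
    rwa [this]
  set C : Set (Set Ω) := {S | ∃ J : Finset (ℝ≥0 × ℕ), (∀ p ∈ J, p.1 ≤ s) ∧ S = cylinder N J}
    with hC
  have hCle : MeasurableSpace.generateFrom C ≤ mΩ := by
    refine MeasurableSpace.generateFrom_le ?_
    rintro _ ⟨J, -, rfl⟩
    exact measurableSet_cylinder fun p _ => hN.measurable _
  have hle : (⨆ u : Set.Iic s, MeasurableSpace.comap (N u) inferInstance)
      ≤ MeasurableSpace.generateFrom C := by
    refine iSup_le fun u => Measurable.comap_le ?_
    refine @measurable_to_countable' _ _ _ _ (MeasurableSpace.generateFrom C) _ fun k => ?_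
    refine MeasurableSpace.measurableSet_generateFrom ⟨{(u.1, k)}, fun p hp => ?_, ?_⟩
    · rw [Finset.mem_singleton.1 hp]; exact u.2
    · ext ω; simp [cylinder]
  have : IsFiniteMeasure (μ.withDensity f) := isFiniteMeasure_withDensity hffin
  have hfin := measure_eq_of_sup (μ := μ.withDensity f) (ν := μ.withDensity g)
    (iSup_le fun u => (hN.measurable _).comap_le) hΘ.comap_le (fun G F' hG hF' => ?_) hA
  · rw [withDensity_apply _ (Filtration.le _ s A hA),
      withDensity_apply _ (Filtration.le _ s A hA)] at hfin
    rw [← lintegral_const_mul _ hΘ.ennreal_ofReal]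
    exact hfin
  · obtain ⟨F, hF, rfl⟩ := hF'
    have hcylm : ∀ J, MeasurableSet (cylinder N J) := fun J =>
      measurableSet_cylinder fun p _ => hN.measurable _
    have hGm : MeasurableSet G := hCle G (hle G hG)
    have hcomp := ext_on_measurableSpace_of_generate_finite (m := MeasurableSpace.generateFrom C)
      mΩ (μ := (μ.withDensity f).restrict (Θ ⁻¹' F)) (ν := (μ.withDensity g).restrict (Θ ⁻¹' F)) C
      ?_ hCle rfl ?_ ?_ (hle G hG)
    · rwa [Measure.restrict_apply hGm, Measure.restrict_apply hGm] at hcomp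
    · rintro _ ⟨J, hJ, rfl⟩
      rw [Measure.restrict_apply (hcylm J), Measure.restrict_apply (hcylm J), Set.inter_comm,
        withDensity_apply _ ((hΘ hF).inter (hcylm J)),
        withDensity_apply _ ((hΘ hF).inter (hcylm J))]
      exact hcyl J hJ F hF
    · rintro _ ⟨J, hJ, rfl⟩ _ ⟨J', hJ', rfl⟩ -
      refine ⟨J ∪ J', fun p hp => (Finset.mem_union.1 hp).elim (hJ p) (hJ' p), ?_⟩
      ext ω
      simp only [cylinder, Set.mem_inter_iff, Set.mem_ofPred_eq, Finset.mem_union]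
      exact ⟨fun ⟨h1, h2⟩ p hp => hp.elim (h1 p) (h2 p),
        fun h3 => ⟨fun p hp => h3 p (Or.inl hp), fun p hp => h3 p (Or.inr hp)⟩⟩
    · have := hcyl ∅ (by simp) F hF
      have h0 : cylinder N ∅ = Set.univ := by ext; simp [cylinder]
      rw [h0, Set.inter_univ] at this
      rw [Measure.restrict_apply_univ, Measure.restrict_apply_univ, withDensity_apply _ (hΘ hF),
        withDensity_apply _ (hΘ hF)]
      exact this

end HasGridIntensity

end Grid

/-! ### Joint law of the increments -/

section MixedPoisson

variable {Ω : Type*} {mΩ : MeasurableSpace Ω} {P : Measure Ω} {N : ℝ≥0 → Ω → ℕ} {Θ : Ω → ℝ}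

lemma lintegral_poissonMeasure (r : ℝ≥0) : ∫⁻ k, (k : ℝ≥0∞) ∂(poissonMeasure r) = r := by
  have hs : HasSum (fun k : ℕ => (k : ℝ) * (Real.exp (-r) * (r : ℝ) ^ k / k.factorial)) r := by
    rw [← hasSum_nat_add_iff' 1]
    have h := (hasSum_one_poissonMeasure r).mul_left (r : ℝ)
    rw [mul_one] at h
    simp only [Finset.range_one, Finset.sum_singleton, CharP.cast_eq_zero, zero_mul, sub_zero]
    have e : ∀ k : ℕ, ((k + 1 : ℕ) : ℝ) * (Real.exp (-r) * (r : ℝ) ^ (k + 1) / (k + 1).factorial)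
        = r * (Real.exp (-r) * (r : ℝ) ^ k / k.factorial) := fun k => by
      rw [Nat.factorial_succ]; push_cast; field_simp; ring
    simpa only [e] using h
  rw [lintegral_countable']
  simp only [poissonMeasure_singleton]
  have e : ∀ k : ℕ, (k : ℝ≥0∞) * ENNReal.ofReal (Real.exp (-r) * (r : ℝ) ^ k / k.factorial)
      = ENNReal.ofReal ((k : ℝ) * (Real.exp (-r) * (r : ℝ) ^ k / k.factorial)) := fun k => by
    rw [ENNReal.ofReal_mul (Nat.cast_nonneg k), ENNReal.ofReal_natCast]
  simp only [e]
  rw [← ENNReal.ofReal_tsum_of_nonneg (fun k => by positivity) hs.summable, hs.tsum_eq,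
    ENNReal.ofReal_coe_nnreal]

/-- The law of an increment given the past, as an identity for integrals of functions of the
past. -/
lemma lintegral_increment_eq [IsProbabilityMeasure P] (hN : IsCountingProcess N)
    (hΘ : Measurable Θ) (hΘint : Integrable Θ P) (hΘ0 : 0 ≤ᵐ[P] Θ)
    (hM : Martingale (fun (t : ℝ≥0) ω => (N t ω : ℝ) - t * Θ ω)
      (filtrationWith N Θ hN.measurable hΘ) P)
    {s t : ℝ≥0} (hst : s ≤ t) {f : Ω → ℝ≥0∞}
    (hf : Measurable[filtrationWith N Θ hN.measurable hΘ s] f) (B : Set ℕ) :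
    ∫⁻ ω in {ω | N t ω - N s ω ∈ B}, f ω ∂P
      = ∫⁻ ω, poissonMeasure ((t - s) * (Θ ω).toNNReal) B * f ω ∂P := by
  set ℱ := filtrationWith N Θ hN.measurable hΘ
  have hD : MeasurableSet {ω | N t ω - N s ω ∈ B} :=
    ((hN.measurable t).sub (hN.measurable s)) (MeasurableSet.of_discrete (s := B))
  have hpm : Measurable fun ω => poissonMeasure ((t - s) * (Θ ω).toNNReal) B :=
    (measurable_poissonMeasure_apply B).comp (hΘ.real_toNNReal.const_mul _)
  -- `measure_increment_eq` says that these two measures agree on the past at s, hence so do their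
  -- integrals of functions of the past.
  have htrim : (P.restrict {ω | N t ω - N s ω ∈ B}).trim (ℱ.le s)
      = (P.withDensity fun ω => poissonMeasure ((t - s) * (Θ ω).toNNReal) B).trim (ℱ.le s) := by
    refine @Measure.ext _ (ℱ s) _ _ fun A hA => ?_
    rw [trim_measurableSet_eq _ hA, trim_measurableSet_eq _ hA,
      Measure.restrict_apply (ℱ.le s A hA), withDensity_apply _ (ℱ.le s A hA)]
    exact measure_increment_eq hN hΘ hΘint hΘ0 hM hst hA B
  rw [← lintegral_trim (ℱ.le s) hf, htrim, lintegral_trim (ℱ.le s) hf,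
    lintegral_withDensity_eq_lintegral_mul _ hpm (hf.mono (ℱ.le s) le_rfl)]
  rfl

/-- The joint law of finitely many increments given `Θ`. -/
lemma lintegral_increments_eq [IsProbabilityMeasure P] (hN : IsCountingProcess N)
    (hΘ : Measurable Θ) (hΘint : Integrable Θ P) (hΘ0 : 0 ≤ᵐ[P] Θ)
    (hM : Martingale (fun (t : ℝ≥0) ω => (N t ω : ℝ) - t * Θ ω)
      (filtrationWith N Θ hN.measurable hΘ) P)
    {τ : ℕ → ℝ≥0} (hτ : Monotone τ) (B : ℕ → Set ℕ) (n : ℕ) :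
    ∀ f : Ω → ℝ≥0∞, Measurable[sigmaOf Θ] f →
    ∫⁻ ω in {ω | ∀ j < n, N (τ (j + 1)) ω - N (τ j) ω ∈ B j}, f ω ∂P
      = ∫⁻ ω, (∏ j ∈ Finset.range n,
          poissonMeasure ((τ (j + 1) - τ j) * (Θ ω).toNNReal) (B j)) * f ω ∂P := by
  have hset : ∀ n, {ω | ∀ j < n, N (τ (j + 1)) ω - N (τ j) ω ∈ B j}
      = ⋂ j ∈ Finset.range n, (fun ω => N (τ (j + 1)) ω - N (τ j) ω) ⁻¹' B j := fun n => by
    ext ω; simp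
  -- The function f is kept general: the Poisson factor of the last increment is a function of `Θ`
  -- and is absorbed into f before the induction hypothesis is applied.
  induction n with
  | zero => intro f _; simp
  | succ n ih =>
    intro f hf
    set R := {ω | ∀ j < n, N (τ (j + 1)) ω - N (τ j) ω ∈ B j} with hR
    have hΘF : Measurable[filtrationWith N Θ hN.measurable hΘ (τ n)] f :=
      hf.mono le_sup_right le_rfl
    have hRF : MeasurableSet[filtrationWith N Θ hN.measurable hΘ (τ n)] R := by
      rw [hR, hset]
      refine Finset.measurableSet_biInter _ fun j hj => ?_
      have hj' := Finset.mem_range.1 hj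
      exact ((measurable_filtrationWith hN.measurable hΘ (hτ hj')).sub
        (measurable_filtrationWith hN.measurable hΘ (hτ hj'.le)))
          (MeasurableSet.of_discrete (s := B j))
    have hRm : MeasurableSet R := Filtration.le _ _ R hRF
    have hsplit : {ω | ∀ j < n + 1, N (τ (j + 1)) ω - N (τ j) ω ∈ B j}
        = R ∩ {ω | N (τ (n + 1)) ω - N (τ n) ω ∈ B n} := by
      ext ω
      simp only [hR, Set.mem_inter_iff, Set.mem_ofPred_eq, Nat.lt_succ_iff_lt_or_eq, or_imp,
        forall_and, forall_eq]
    have hpm : Measurable[sigmaOf Θ]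
        fun ω => poissonMeasure ((τ (n + 1) - τ n) * (Θ ω).toNNReal) (B n) :=
      (measurable_poissonMeasure_apply (B n)).comp
        ((comap_measurable Θ).real_toNNReal.const_mul _)
    rw [hsplit, ← setLIntegral_indicator hRm,
      lintegral_increment_eq hN hΘ hΘint hΘ0 hM (hτ n.le_succ) (hΘF.indicator hRF) (B n)]
    have := ih (fun ω => poissonMeasure ((τ (n + 1) - τ n) * (Θ ω).toNNReal) (B n) * f ω)
      (hpm.mul hf)
    rw [← lintegral_indicator hRm] at this
    calc _ = ∫⁻ ω, R.indicator (fun ω => poissonMeasure ((τ (n + 1) - τ n) * (Θ ω).toNNReal) (B n)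
              * f ω) ω ∂P := by
          refine lintegral_congr fun ω => ?_
          by_cases hω : ω ∈ R <;> simp [hω]
      _ = _ := by
          rw [this]
          refine lintegral_congr fun ω => ?_
          rw [Finset.prod_range_succ, mul_assoc]

end MixedPoisson

/-! ### Mixed Poisson processes are the counting processes with intensity `Θ` -/

section MixedPoisson

variable {Ω : Type*} {mΩ : MeasurableSpace Ω} {P : Measure Ω} {N : ℝ≥0 → Ω → ℕ} {Θ : Ω → ℝ}

lemma condExp_indicator_eq_of_measure [IsProbabilityMeasure P] {m : MeasurableSpace Ω}
    (hm : m ≤ mΩ) {E : Set Ω} (hE : MeasurableSet[mΩ] E) {q : Ω → ℝ≥0∞} (hq : Measurable[m] q)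
    (hq1 : ∀ ω, q ω ≤ 1) (h : ∀ F, MeasurableSet[m] F → P (F ∩ E) = ∫⁻ ω in F, q ω ∂P) :
    P⟦E | m⟧ =ᵐ[P] fun ω => (q ω).toReal := by
  have hqint : Integrable (fun ω => (q ω).toReal) P := by
    refine Integrable.of_bound (C := 1)
      (hq.mono hm le_rfl).ennreal_toReal.aestronglyMeasurable (Eventually.of_forall fun ω => ?_)
    rw [Real.norm_eq_abs, abs_of_nonneg ENNReal.toReal_nonneg]
    exact ENNReal.toReal_le_of_le_ofReal zero_le_one (by simpa using hq1 ω)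
  refine (ae_eq_condExp_of_forall_setIntegral_eq hm ((integrable_const (1 : ℝ)).indicator hE)
    (fun _ _ _ => hqint.integrableOn) (fun F hF _ => ?_)
    hq.ennreal_toReal.stronglyMeasurable.aestronglyMeasurable).symm
  rw [integral_toReal (hq.mono hm le_rfl).aemeasurable
    (Eventually.of_forall fun ω => (hq1 ω).trans_lt ENNReal.one_lt_top), ← h F hF,
    integral_indicator hE, Measure.restrict_restrict hE, setIntegral_const, smul_eq_mul, mul_one,
    measureReal_def, Set.inter_comm]

lemma measurable_increments (hN : ∀ t, Measurable (N t)) {m : ℕ} (t : Fin (m + 1) → ℝ≥0)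
    (h : ℝ≥0) (j : Fin m) : Measurable fun ω => increments N t h ω j :=
  ((measurable_from_top (f := fun k : ℕ => (k : ℝ))).comp (hN _)).sub
    ((measurable_from_top (f := fun k : ℕ => (k : ℝ))).comp (hN _))

/-- The joint law of the increments given `Θ`, for the increments over a finite partition. -/
lemma measure_increments_eq [IsProbabilityMeasure P] (hN : IsCountingProcess N)
    (hΘ : Measurable Θ) (hΘint : Integrable Θ P) (hΘ0 : 0 ≤ᵐ[P] Θ)
    (hM : Martingale (fun (t : ℝ≥0) ω => (N t ω : ℝ) - t * Θ ω)
      (filtrationWith N Θ hN.measurable hΘ) P)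
    {m : ℕ} {t : Fin (m + 1) → ℝ≥0} (ht : Monotone t) (h : ℝ≥0) (s : Finset (Fin m))
    (B : Fin m → Set ℝ) {F : Set Ω} (hF : MeasurableSet[sigmaOf Θ] F) :
    P (F ∩ ⋂ i ∈ s, (fun ω => increments N t h ω i) ⁻¹' B i)
      = ∫⁻ ω in F, ∏ i ∈ s, poissonMeasure ((t i.succ - t i.castSucc) * (Θ ω).toNNReal)
          (Nat.cast ⁻¹' B i) ∂P := by
  classical
  have hFm : MeasurableSet F := hΘ.comap_le F hF
  -- The finite partition, shifted by h, is frozen after its last point to obtain a monotone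
  -- sequence. Indices outside s are left unconstrained and contribute factors 1.
  set τ : ℕ → ℝ≥0 := fun j => h + t ⟨min j m, by omega⟩ with hτdef
  have hτ : Monotone τ := fun i j hij => by
    simp only [hτdef]
    gcongr
    exact ht (Fin.mk_le_mk.2 (min_le_min_right m hij))
  have hτs : ∀ i : Fin m, τ (i + 1) = h + t i.succ := fun i => by
    simp only [hτdef]; congr 2; ext; simp
  have hτc : ∀ i : Fin m, τ i = h + t i.castSucc := fun i => by
    simp only [hτdef]; congr 2; ext; simp
  set B' : ℕ → Set ℕ := fun j =>
    if hj : j < m then (if (⟨j, hj⟩ : Fin m) ∈ s then Nat.cast ⁻¹' B ⟨j, hj⟩ else Set.univ)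
    else Set.univ with hB'
  have hB's : ∀ i : Fin m, B' i = if i ∈ s then Nat.cast ⁻¹' B i else Set.univ := fun i => by
    simp [hB']
  have hset : {ω | ∀ j < m, N (τ (j + 1)) ω - N (τ j) ω ∈ B' j}
      = ⋂ i ∈ s, (fun ω => increments N t h ω i) ⁻¹' B i := by
    ext ω
    simp only [Set.mem_ofPred_eq, Set.mem_iInter, Set.mem_preimage]
    have hinc : ∀ i : Fin m, ((N (τ (i + 1)) ω - N (τ i) ω : ℕ) : ℝ) = increments N t h ω i :=
      fun i => by
        rw [Nat.cast_sub (hN.monotone ω (hτ (Nat.le_succ i))), hτs, hτc, increments]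
    constructor
    · intro hω i hi
      have := hω i i.2
      rw [hB's, if_pos hi, Set.mem_preimage, hinc] at this
      exact this
    · intro hω j hj
      rw [hB's ⟨j, hj⟩]
      split_ifs with hi
      · rw [Set.mem_preimage, hinc ⟨j, hj⟩]
        exact hω _ hi
      · trivial
  have key := lintegral_increments_eq hN hΘ hΘint hΘ0 hM hτ B' m (F.indicator fun _ => 1)
    (measurable_const.indicator hF)
  rw [hset, lintegral_indicator_const hFm, Measure.restrict_apply hFm, one_mul] at key
  rw [key, ← lintegral_indicator hFm]
  refine lintegral_congr fun ω => ?_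
  by_cases hω : ω ∈ F
  · rw [Set.indicator_of_mem hω, Set.indicator_of_mem hω, mul_one, Finset.prod_range]
    simp only [hB's, hτs, hτc, add_tsub_add_eq_tsub_left]
    rw [← Finset.prod_filter_mul_prod_filter_not Finset.univ (· ∈ s)]
    rw [Finset.prod_congr rfl fun i hi => by rw [if_pos (Finset.mem_filter.1 hi).2],
      Finset.prod_eq_one (s := Finset.univ.filter (· ∉ s)) fun i hi => by
        rw [if_neg (Finset.mem_filter.1 hi).2, measure_univ], mul_one]
    simp
  · rw [Set.indicator_of_notMem hω, Set.indicator_of_notMem hω, mul_zero]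

/-- The product form on the right is conditional independence, by comparison with singletons s. That
h is absent from the right, already in `measure_increments_eq`, is stationarity. -/
lemma condExp_increments_eq [IsProbabilityMeasure P] (hN : IsCountingProcess N)
    (hΘ : Measurable Θ) (hΘint : Integrable Θ P) (hΘ0 : 0 ≤ᵐ[P] Θ)
    (hM : Martingale (fun (t : ℝ≥0) ω => (N t ω : ℝ) - t * Θ ω)
      (filtrationWith N Θ hN.measurable hΘ) P)
    {m : ℕ} {t : Fin (m + 1) → ℝ≥0} (ht : Monotone t) (h : ℝ≥0) (s : Finset (Fin m))
    {B : Fin m → Set ℝ} (hB : ∀ i, MeasurableSet (B i)) :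
    P⟦⋂ i ∈ s, (fun ω => increments N t h ω i) ⁻¹' B i | sigmaOf Θ⟧ =ᵐ[P]
      fun ω => ∏ i ∈ s, (poissonMeasure ((t i.succ - t i.castSucc) * (Θ ω).toNNReal)).real
          (Nat.cast ⁻¹' B i) := by
  have hE : MeasurableSet (⋂ i ∈ s, (fun ω => increments N t h ω i) ⁻¹' B i) :=
    Finset.measurableSet_biInter _ fun i _ => measurable_increments hN.measurable t h i (hB i)
  have := condExp_indicator_eq_of_measure hΘ.comap_le hE
    (q := fun ω => ∏ i ∈ s, poissonMeasure ((t i.succ - t i.castSucc) * (Θ ω).toNNReal)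
      (Nat.cast ⁻¹' B i)) (Finset.measurable_prod _ fun i _ =>
        (measurable_poissonMeasure_apply _).comp
          ((comap_measurable Θ).real_toNNReal.const_mul _))
    (fun ω => Finset.prod_le_one' fun i _ => prob_le_one)
    (fun F hF => measure_increments_eq hN hΘ hΘint hΘ0 hM ht h s B hF)
  simp only [ENNReal.toReal_prod] at this
  exact this

/-- A counting process with intensity `Θ` is a mixed Poisson process with parameter `Θ`. -/
lemma isMixedPoisson_of_martingale [IsProbabilityMeasure P] (hN : IsCountingProcess N)
    (hΘ : Measurable Θ) (hΘint : Integrable Θ P) (hΘ0 : 0 ≤ᵐ[P] Θ)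
    (hM : Martingale (fun (t : ℝ≥0) ω => (N t ω : ℝ) - t * Θ ω)
      (filtrationWith N Θ hN.measurable hΘ) P) : IsMixedPoisson P N Θ where
  counting := hN
  indep := by
    intro m t ht0 ht s B hB
    have h1 : ∀ i, P⟦(fun ω => increments N t 0 ω i) ⁻¹' B i | sigmaOf Θ⟧ =ᵐ[P]
        fun ω => (poissonMeasure ((t i.succ - t i.castSucc) * (Θ ω).toNNReal)).real
          (Nat.cast ⁻¹' B i) := fun i => by
      simpa using condExp_increments_eq hN hΘ hΘint hΘ0 hM ht.monotone 0 {i} hB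
    refine (condExp_increments_eq hN hΘ hΘint hΘ0 hM ht.monotone 0 s hB).trans ?_
    filter_upwards [ae_all_iff.2 h1] with ω hω
    rw [Finset.prod_apply]
    exact Finset.prod_congr rfl fun i _ => (hω i).symm
  stationary := by
    intro m t ht0 ht h F hF B hB
    have hm : ∀ h, Measurable (increments N t h) := fun h =>
      measurable_pi_iff.2 fun j => measurable_increments hN.measurable t h j
    have hFm : MeasurableSet F := hΘ.comap_le F hF
    have hpi : ∀ h, ∀ B : Fin m → Set ℝ, increments N t h ⁻¹' Set.univ.pi B
        = ⋂ i ∈ Finset.univ, (fun ω => increments N t h ω i) ⁻¹' B i := fun h B => by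
      ext; simp
    have heq : (P.restrict F).map (increments N t h) = (P.restrict F).map (increments N t 0) := by
      refine ext_of_generate_finite _ generateFrom_pi.symm isPiSystem_pi ?_ ?_
      · rintro _ ⟨B, hB, rfl⟩
        have hBm : MeasurableSet (Set.univ.pi B) :=
          MeasurableSet.univ_pi fun i => hB i (Set.mem_univ i)
        rw [Measure.map_apply (hm h) hBm, Measure.map_apply (hm 0) hBm,
          Measure.restrict_apply (hm h hBm), Measure.restrict_apply (hm 0 hBm), hpi, hpi,
          Set.inter_comm, measure_increments_eq hN hΘ hΘint hΘ0 hM ht.monotone h _ _ hF,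
          Set.inter_comm, measure_increments_eq hN hΘ hΘint hΘ0 hM ht.monotone 0 _ _ hF]
      · rw [Measure.map_apply (hm h) MeasurableSet.univ,
          Measure.map_apply (hm 0) MeasurableSet.univ]
        simp
    have := congrArg (fun ν => ν B) heq
    simp only [Measure.map_apply (hm h) hB, Measure.map_apply (hm 0) hB,
      Measure.restrict_apply (hm h hB), Measure.restrict_apply (hm 0 hB)] at this
    rwa [Set.inter_comm F, Set.inter_comm F]
  condLaw := by
    intro t ht B
    have hE : MeasurableSet (N t ⁻¹' B) := hN.measurable t (MeasurableSet.of_discrete)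
    refine condExp_indicator_eq_of_measure hΘ.comap_le hE
      (q := fun ω => poissonMeasure (t * (Θ ω).toNNReal) B)
      ((measurable_poissonMeasure_apply _).comp
          ((comap_measurable Θ).real_toNNReal.const_mul _))
      (fun ω => prob_le_one) fun F hF => ?_
    have hF' : MeasurableSet[filtrationWith N Θ hN.measurable hΘ 0] F :=
      (le_sup_right : sigmaOf Θ ≤ filtrationWith N Θ hN.measurable hΘ 0) F hF
    have := measure_increment_eq hN hΘ hΘint hΘ0 hM (zero_le : 0 ≤ t) hF' B
    simp only [hN.zero, tsub_zero] at this
    exact this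

/-- For a mixed Poisson process, a step of the grid is conditionally independent of the previous
steps, with a Poisson law. -/
lemma IsMixedPoisson.measure_step [IsProbabilityMeasure P] (h : IsMixedPoisson P N Θ)
    (hΘ : Measurable Θ) (n i k : ℕ) {B : Fin (i + 1) → Set ℝ} (hB : ∀ j, MeasurableSet (B j))
    {F : Set Ω} (hF : MeasurableSet[sigmaOf Θ] F) :
    P (F ∩ (⋂ j ∈ Finset.univ.erase (Fin.last i),
          (fun ω => increments N (fun l : Fin (i + 1 + 1) => gridPoint n l) 0 ω j) ⁻¹' B j)
        ∩ {ω | N (gridPoint n (i + 1)) ω - N (gridPoint n i) ω = k})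
      = ∫⁻ ω in F ∩ (⋂ j ∈ Finset.univ.erase (Fin.last i),
          (fun ω => increments N (fun l : Fin (i + 1 + 1) => gridPoint n l) 0 ω j) ⁻¹' B j),
          poissonMeasure (gridPoint n 1 * (Θ ω).toNNReal) {k} ∂P := by
  have hN := h.counting
  set t : Fin (i + 1 + 1) → ℝ≥0 := fun l => gridPoint n l with ht
  have ht0 : t 0 = 0 := by simp [ht, gridPoint]
  have htm : StrictMono t := fun a b hab => gridPoint_strictMono n hab
  set R := ⋂ j ∈ Finset.univ.erase (Fin.last i), (fun ω => increments N t 0 ω j) ⁻¹' B j with hR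
  set D := {ω | N (gridPoint n (i + 1)) ω - N (gridPoint n i) ω = k} with hD
  set q : Ω → ℝ := fun ω => (poissonMeasure (gridPoint n 1 * (Θ ω).toNNReal)).real {k} with hq
  have hFm : MeasurableSet F := hΘ.comap_le F hF
  have hRm : MeasurableSet R :=
    Finset.measurableSet_biInter _ fun j _ => measurable_increments hN.measurable t 0 j (hB j)
  have hDm : MeasurableSet D := ((hN.measurable _).sub (hN.measurable _))
    (measurableSet_singleton k)
  have hpm : Measurable[sigmaOf Θ] fun ω => poissonMeasure (gridPoint n 1 * (Θ ω).toNNReal) {k} :=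
    (measurable_poissonMeasure_apply _).comp ((comap_measurable Θ).real_toNNReal.const_mul _)
  have hqm : StronglyMeasurable[sigmaOf Θ] q := hpm.ennreal_toReal.stronglyMeasurable
  have hq1 : ∀ ω, ‖q ω‖ ≤ 1 := fun ω => by
    rw [Real.norm_eq_abs, abs_of_nonneg measureReal_nonneg]; exact measureReal_le_one
  have hDinc : D = (fun ω => increments N t 0 ω (Fin.last i)) ⁻¹' {(k : ℝ)} := by
    ext ω
    have hle := hN.monotone ω (gridPoint_mono n i.le_succ)
    simp only [hD, increments, ht, Set.mem_ofPred_eq, Set.mem_preimage, Set.mem_singleton_iff,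
      zero_add, Fin.val_succ, Fin.val_castSucc, Fin.val_last]
    rw [← Nat.cast_sub hle, Nat.cast_inj]
  -- Stationarity moves the step to the interval from 0 to the first grid point, where the
  -- conditional law is given.
  have hcondD : P⟦D | sigmaOf Θ⟧ =ᵐ[P] q := by
    have hstat : ∀ G, MeasurableSet[sigmaOf Θ] G →
        P (G ∩ D) = P (G ∩ N (gridPoint n 1) ⁻¹' {k}) := by
      intro G hG
      have hg1 : 0 < gridPoint n 1 := by simp only [gridPoint]; positivity
      have hB' : MeasurableSet {v : Fin 1 → ℝ | v 0 = k} :=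
        measurableSet_eq_fun (measurable_pi_apply 0) measurable_const
      have hs := h.stationary 1 ![0, gridPoint n 1] rfl
        (by intro a b hab; fin_cases a <;> fin_cases b <;> simp_all) (gridPoint n i) G hG _ hB'
      convert hs using 3
      · ext ω
        have hle := hN.monotone ω (gridPoint_mono n i.le_succ)
        have e : gridPoint n i + gridPoint n 1 = gridPoint n (i + 1) := by
          simp only [gridPoint]; push_cast; ring
        simp only [hD, increments, Set.mem_ofPred_eq, Set.mem_preimage]
        simp only [Fin.succ_zero_eq_one, Fin.castSucc_zero, Matrix.cons_val_zero,
          Matrix.cons_val_one, add_zero, e]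
        rw [← Nat.cast_sub hle, Nat.cast_inj]
      · ext ω
        simp only [increments, Set.mem_ofPred_eq, Set.mem_preimage]
        simp [hN.zero]
    have hc := h.condLaw (gridPoint n 1) (by simp only [gridPoint]; positivity) {k}
    refine (ae_eq_condExp_of_forall_setIntegral_eq hΘ.comap_le
      ((integrable_const (1 : ℝ)).indicator hDm)
      (fun _ _ _ => (Integrable.of_bound (hqm.mono hΘ.comap_le).aestronglyMeasurable 1
        (Eventually.of_forall hq1)).integrableOn) (fun G hG _ => ?_)
      hqm.aestronglyMeasurable).symm
    have hGm : MeasurableSet G := hΘ.comap_le G hG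
    have hkm : MeasurableSet (N (gridPoint n 1) ⁻¹' {k}) :=
      hN.measurable _ (measurableSet_singleton k)
    calc ∫ ω in G, q ω ∂P
        = ∫ ω in G, (P⟦N (gridPoint n 1) ⁻¹' {k} | sigmaOf Θ⟧) ω ∂P :=
          integral_congr_ae (ae_restrict_of_ae hc.symm)
      _ = ∫ ω in G, (N (gridPoint n 1) ⁻¹' {k}).indicator (fun _ => (1 : ℝ)) ω ∂P :=
          setIntegral_condExp hΘ.comap_le ((integrable_const (1 : ℝ)).indicator hkm) hG
      _ = ∫ ω in G, D.indicator (fun _ => (1 : ℝ)) ω ∂P := by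
          rw [integral_indicator hDm, integral_indicator hkm, Measure.restrict_restrict hDm,
            Measure.restrict_restrict hkm]
          simp only [setIntegral_const, measureReal_def]
          rw [Set.inter_comm D, hstat G hG, Set.inter_comm G]
  have hcondRD : P⟦R ∩ D | sigmaOf Θ⟧ =ᵐ[P] P⟦R | sigmaOf Θ⟧ * q := by
    classical
    -- Conditional independence is used twice, with all indices and with the last one erased;
    -- comparing the two products splits off the last step.
    set B' : Fin (i + 1) → Set ℝ := Function.update B (Fin.last i) {(k : ℝ)} with hB'
    have hB'm : ∀ j, MeasurableSet (B' j) := fun j => by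
      by_cases hj : j = Fin.last i
      · subst hj; simp [hB']
      · simp [hB', hj, hB j]
    have h1 := h.indep (i + 1) t ht0 htm Finset.univ B' hB'm
    have h2 := h.indep (i + 1) t ht0 htm (Finset.univ.erase (Fin.last i)) B' hB'm
    rw [← Finset.mul_prod_erase _ _ (Finset.mem_univ (Fin.last i))] at h1
    have hR' : ⋂ j ∈ Finset.univ.erase (Fin.last i), (fun ω => increments N t 0 ω j) ⁻¹' B' j
        = R := by
      refine Set.iInter₂_congr fun j hj => ?_
      rw [hB', Function.update_of_ne (Finset.ne_of_mem_erase hj)]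
    have hRD : ⋂ j ∈ Finset.univ, (fun ω => increments N t 0 ω j) ⁻¹' B' j = R ∩ D := by
      rw [← Finset.insert_erase (Finset.mem_univ (Fin.last i)), Finset.set_biInter_insert, hR',
        hB', Function.update_self, ← hDinc, Set.inter_comm]
    have hDB : (fun ω => increments N t 0 ω (Fin.last i)) ⁻¹' B' (Fin.last i) = D := by
      rw [hB', Function.update_self, ← hDinc]
    rw [hRD, hDB] at h1
    rw [hR'] at h2
    filter_upwards [h1, h2, hcondD] with ω e1 e2 e3
    rw [e1, Pi.mul_apply, Pi.mul_apply, e2, e3, mul_comm]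
  have hint : ∀ S, MeasurableSet S → Integrable (S.indicator fun _ => (1 : ℝ)) P := fun S hS =>
    (integrable_const (1 : ℝ)).indicator hS
  have hRqint : Integrable (R.indicator (fun _ => (1 : ℝ)) * q) P :=
    (hint R hRm).mul_bdd (hqm.mono hΘ.comap_le).aestronglyMeasurable (Eventually.of_forall hq1)
  have hpull := condExp_mul_of_stronglyMeasurable_right (m := sigmaOf Θ) hqm hRqint (hint R hRm)
  have hreal : ∫ ω in F, (R ∩ D).indicator (fun _ => (1 : ℝ)) ω ∂P
      = ∫ ω in F, (R.indicator (fun _ => (1 : ℝ)) * q) ω ∂P := by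
    rw [← setIntegral_condExp hΘ.comap_le (hint _ (hRm.inter hDm)) hF,
      ← setIntegral_condExp hΘ.comap_le hRqint hF]
    exact integral_congr_ae (ae_restrict_of_ae (hcondRD.trans hpull.symm))
  have hRq : R.indicator (fun _ => (1 : ℝ)) * q = R.indicator q := by
    funext ω
    by_cases hω : ω ∈ R <;> simp [hω]
  rw [hRq, integral_indicator (hRm.inter hDm), integral_indicator hRm,
    Measure.restrict_restrict (hRm.inter hDm), Measure.restrict_restrict hRm, setIntegral_const,
    smul_eq_mul, mul_one, measureReal_def] at hreal
  simp only [hq, measureReal_def] at hreal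
  rw [integral_toReal (hpm.mono hΘ.comap_le le_rfl).aemeasurable
    (Eventually.of_forall fun ω => measure_lt_top _ _)] at hreal
  rw [Set.inter_assoc, Set.inter_comm F, Set.inter_comm F]
  refine (ENNReal.toReal_eq_toReal_iff' (measure_ne_top _ _) (ne_of_lt ?_)).1 hreal
  calc _ ≤ ∫⁻ _ in R ∩ F, 1 ∂P := lintegral_mono fun ω => prob_le_one
    _ < ∞ := by simp [measure_lt_top]

/-- A mixed Poisson process has intensity `Θ` along grids. -/
lemma IsMixedPoisson.hasGridIntensity [IsProbabilityMeasure P] (h : IsMixedPoisson P N Θ)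
    (hΘ : Measurable Θ) : HasGridIntensity P N Θ := by
  have hN := h.counting
  intro n i J hJ F hF
  set D : Ω → ℕ := fun ω => N (gridPoint n (i + 1)) ω - N (gridPoint n i) ω with hD
  have hDm : Measurable D := (hN.measurable _).sub (hN.measurable _)
  have hDeq : ∀ ω, ENNReal.ofReal ((N (gridPoint n (i + 1)) ω : ℝ) - N (gridPoint n i) ω)
      = (D ω : ℝ≥0∞) := fun ω => by
    rw [← Nat.cast_sub (hN.monotone ω (gridPoint_mono n i.le_succ)), ENNReal.ofReal_natCast]
  have hpm : ∀ k : ℕ, Measurable fun ω => poissonMeasure (gridPoint n 1 * (Θ ω).toNNReal) {k} :=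
    fun k => (measurable_poissonMeasure_apply _).comp (hΘ.real_toNNReal.const_mul _)
  have hFσ : MeasurableSet[sigmaOf Θ] (Θ ⁻¹' F) := ⟨F, hF, rfl⟩
  -- `V` records the values at the grid points up to i. It takes countably many values, so it
  -- suffices to treat its atoms, which `hatom` does.
  set V : Ω → Fin (i + 1) → ℕ := fun ω j => N (gridPoint n j) ω with hV
  have hVm : Measurable V := measurable_pi_iff.2 fun j => hN.measurable _
  set f : Ω → ℝ≥0∞ := fun ω => (D ω : ℝ≥0∞) with hf
  set g : Ω → ℝ≥0∞ := fun ω => ENNReal.ofReal (1 / ((n : ℝ) + 1)) * ENNReal.ofReal (Θ ω) with hg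
  have hfm : Measurable f := (measurable_from_top (f := fun k : ℕ => (k : ℝ≥0∞))).comp hDm
  have hatom : ∀ v : Fin (i + 1) → ℕ,
      ∫⁻ ω in Θ ⁻¹' F ∩ V ⁻¹' {v}, f ω ∂P = ∫⁻ ω in Θ ⁻¹' F ∩ V ⁻¹' {v}, g ω ∂P := by
    intro v
    by_cases hv : v 0 = 0
    swap
    · have : V ⁻¹' {v} = ∅ := by
        ext ω
        simp only [Set.mem_preimage, Set.mem_singleton_iff, Set.mem_empty_iff_false, iff_false]
        intro hω
        apply hv
        rw [← hω]
        simp [hV, gridPoint, hN.zero]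
      simp [this]
    -- Since N starts at 0, the values at the grid points up to i are equivalent to the increments
    -- before step i; the last index, which is step i itself, is left free.
    set B : Fin (i + 1) → Set ℝ := fun j =>
      if hj : (j : ℕ) < i then {(v ⟨j + 1, by omega⟩ : ℝ) - v j} else Set.univ with hB
    have hBm : ∀ j, MeasurableSet (B j) := fun j => by
      simp only [hB]; split_ifs
      · exact measurableSet_singleton _
      · exact MeasurableSet.univ
    have hset : V ⁻¹' {v} = ⋂ j ∈ Finset.univ.erase (Fin.last i),
        (fun ω => increments N (fun l : Fin (i + 1 + 1) => gridPoint n l) 0 ω j) ⁻¹' B j := by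
      ext ω
      simp only [Set.mem_preimage, Set.mem_singleton_iff, Set.mem_iInter, Finset.mem_erase,
        Finset.mem_univ, and_true]
      constructor
      · rintro rfl j hj
        have hj' : (j : ℕ) < i := by
          have := j.2
          have : (j : ℕ) ≠ i := fun e => hj (Fin.ext e)
          omega
        simp [hB, hj', hV, increments]
      · intro hω
        have : ∀ l (hl : l < i + 1), N (gridPoint n l) ω = v ⟨l, hl⟩ := by
          intro l
          induction l with
          | zero => intro hl; simpa [gridPoint, hN.zero] using hv.symm
          | succ l ih =>
            intro hl
            have hl' : l < i := by omega
            have := hω ⟨l, by omega⟩ (fun e => by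
              have := congrArg Fin.val e
              simp at this
              omega)
            have ihl := ih (by omega)
            simp only [hB, hl', dif_pos, increments, Set.mem_singleton_iff, zero_add,
              Fin.val_succ, Fin.val_castSucc, ihl] at this
            have h2 : (N (gridPoint n (l + 1)) ω : ℝ) = v ⟨l + 1, hl⟩ := by linarith
            exact_mod_cast h2
        funext j
        exact this j j.2
    rw [hset]
    set E := Θ ⁻¹' F ∩ ⋂ j ∈ Finset.univ.erase (Fin.last i),
        (fun ω => increments N (fun l : Fin (i + 1 + 1) => gridPoint n l) 0 ω j) ⁻¹' B j with hE
    have hstep : ∀ k : ℕ, P (E ∩ {ω | D ω = k})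
        = ∫⁻ ω in E, poissonMeasure (gridPoint n 1 * (Θ ω).toNNReal) {k} ∂P := fun k =>
      h.measure_step hΘ n i k hBm hFσ
    calc ∫⁻ ω in E, f ω ∂P = ∫⁻ k, (k : ℝ≥0∞) ∂((P.restrict E).map D) :=
          (lintegral_map (measurable_from_top (f := fun k : ℕ => (k : ℝ≥0∞))) hDm).symm
      _ = ∑' k : ℕ, (k : ℝ≥0∞) * P (E ∩ {ω | D ω = k}) := by
          rw [lintegral_countable']
          refine tsum_congr fun k => ?_
          rw [Measure.map_apply hDm (measurableSet_singleton k),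
            Measure.restrict_apply (hDm (measurableSet_singleton k)), Set.inter_comm]
          rfl
      _ = ∑' k : ℕ, ∫⁻ ω in E, (k : ℝ≥0∞) *
            poissonMeasure (gridPoint n 1 * (Θ ω).toNNReal) {k} ∂P := by
          refine tsum_congr fun k => ?_
          rw [hstep, lintegral_const_mul _ (hpm k)]
      _ = ∫⁻ ω in E, ∑' k : ℕ, (k : ℝ≥0∞) *
            poissonMeasure (gridPoint n 1 * (Θ ω).toNNReal) {k} ∂P :=
          (lintegral_tsum fun k => ((hpm k).const_mul _).aemeasurable).symm
      _ = ∫⁻ ω in E, g ω ∂P := by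
          refine lintegral_congr fun ω => ?_
          rw [← lintegral_countable', lintegral_poissonMeasure]
          simp only [hg, gridPoint, Nat.cast_one]
          rw [ENNReal.coe_mul, ENNReal.ofReal, ENNReal.ofReal]
          congr 2
          ext
          rw [Real.coe_toNNReal _ (by positivity)]
          push_cast
          rfl
  simp only [hDeq]
  rw [← lintegral_const_mul _ hΘ.ennreal_ofReal]
  have hmeas : ((P.withDensity f).restrict (Θ ⁻¹' F)).map V
      = ((P.withDensity g).restrict (Θ ⁻¹' F)).map V := by
    refine Measure.ext_of_singleton fun v => ?_
    have hvm := hVm (measurableSet_singleton v)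
    rw [Measure.map_apply hVm (measurableSet_singleton v),
      Measure.map_apply hVm (measurableSet_singleton v), Measure.restrict_apply hvm,
      Measure.restrict_apply hvm, withDensity_apply _ (hvm.inter (hΘ hF)),
      withDensity_apply _ (hvm.inter (hΘ hF)), Set.inter_comm]
    exact hatom v
  have hJset : {ω | ∀ p ∈ J, N (gridPoint n p.1) ω = p.2}
      = V ⁻¹' {v | ∀ p ∈ J, ∀ hp : p.1 < i + 1, v ⟨p.1, hp⟩ = p.2} := by
    ext ω
    simp only [Set.mem_preimage, Set.mem_ofPred_eq, hV]
    exact forall₂_congr fun p hp => ⟨fun h _ => h, fun h => h (Nat.lt_succ_of_le (hJ p hp))⟩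
  have hm : MeasurableSet {v : Fin (i + 1) → ℕ | ∀ p ∈ J, ∀ hp : p.1 < i + 1, v ⟨p.1, hp⟩ = p.2} :=
    MeasurableSet.of_discrete
  have := congrArg (fun ν => ν {v | ∀ p ∈ J, ∀ hp : p.1 < i + 1, v ⟨p.1, hp⟩ = p.2}) hmeas
  simp only [Measure.map_apply hVm hm, Measure.restrict_apply (hVm hm),
    withDensity_apply _ ((hVm hm).inter (hΘ hF))] at this
  rw [hJset, Set.inter_comm]
  exact this

end MixedPoisson

/-! ### Disintegration over the law of `Θ` -/

section Disintegration

variable {Ω : Type*} {mΩ : MeasurableSpace Ω} {P : Measure Ω} {Θ : Ω → ℝ}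
  {κ : Kernel (Set.Ioi (0 : ℝ)) Ω}

lemma lawOn_apply (hΘ : Measurable Θ) {B : Set (Set.Ioi (0 : ℝ))} (hB : MeasurableSet B) :
    lawOn P Θ B = P (Θ ⁻¹' (Subtype.val '' B)) := by
  have hv : MeasurableEmbedding (Subtype.val : Set.Ioi (0 : ℝ) → ℝ) :=
    MeasurableEmbedding.subtype_coe measurableSet_Ioi
  rw [lawOn, hv.comap_apply, Measure.map_apply hΘ (hv.measurableSet_image.2 hB)]

lemma isFiniteMeasure_lawOn [IsFiniteMeasure P] (hΘ : Measurable Θ) :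
    IsFiniteMeasure (lawOn P Θ) :=
  ⟨by rw [lawOn_apply hΘ MeasurableSet.univ]; exact measure_lt_top _ _⟩

namespace IsConsistentRCP

variable (hκ : IsConsistentRCP P Θ κ) (hΘ : Measurable Θ)
include hκ hΘ

/-- By consistency P_θ is carried by {Θ ∈ B} for almost all θ in B, and by {Θ ∈ Bᶜ} for almost all
other θ. Restricting θ to B is therefore the same as intersecting D with {Θ ∈ B}. -/
lemma setLIntegral_apply {B : Set (Set.Ioi (0 : ℝ))} (hB : MeasurableSet B) {D : Set Ω}
    (hD : MeasurableSet D) :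
    ∫⁻ θ in B, κ θ D ∂(lawOn P Θ) = P (D ∩ Θ ⁻¹' (Subtype.val '' B)) := by
  have := hκ.markov
  have hv : MeasurableEmbedding (Subtype.val : Set.Ioi (0 : ℝ) → ℝ) :=
    MeasurableEmbedding.subtype_coe measurableSet_Ioi
  have hBm : MeasurableSet (Θ ⁻¹' (Subtype.val '' B)) := hΘ (hv.measurableSet_image.2 hB)
  have hBcm : MeasurableSet (Θ ⁻¹' (Subtype.val '' Bᶜ)) := hΘ (hv.measurableSet_image.2 hB.compl)
  rw [← hκ.lintegral_eq _ (hD.inter hBm), ← lintegral_indicator hB]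
  refine lintegral_congr_ae ?_
  filter_upwards [hκ.consistent B hB, hκ.consistent Bᶜ hB.compl] with θ h1 h2
  by_cases hθ : θ ∈ B
  · rw [Set.indicator_of_mem hθ]
    have h3 : κ θ (Θ ⁻¹' (Subtype.val '' B))ᶜ = 0 := (prob_compl_eq_zero_iff hBm).2 (h1 hθ)
    exact (measure_inter_conull h3).symm
  · rw [Set.indicator_of_notMem hθ]
    have h3 : κ θ (Θ ⁻¹' (Subtype.val '' Bᶜ))ᶜ = 0 := (prob_compl_eq_zero_iff hBcm).2 (h2 hθ)
    refine (measure_mono_null ?_ h3).symm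
    rintro ω ⟨-, ⟨x, hx, hx'⟩⟩ ⟨y, hy, hy'⟩
    exact hy (by rwa [Subtype.ext (hy'.trans hx'.symm)])

lemma setLIntegral_lintegral {B : Set (Set.Ioi (0 : ℝ))} (hB : MeasurableSet B) {f : Ω → ℝ≥0∞}
    (hf : Measurable f) :
    ∫⁻ θ in B, ∫⁻ ω, f ω ∂(κ θ) ∂(lawOn P Θ) = ∫⁻ ω in Θ ⁻¹' (Subtype.val '' B), f ω ∂P := by
  have hbind : ((lawOn P Θ).restrict B).bind κ = P.restrict (Θ ⁻¹' (Subtype.val '' B)) := by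
    ext D hD
    rw [Measure.bind_apply hD κ.measurable.aemeasurable, Measure.restrict_apply hD]
    exact hκ.setLIntegral_apply hΘ hB hD
  rw [← hbind, Measure.lintegral_bind κ.measurable.aemeasurable hf.aemeasurable]

lemma lintegral_lintegral (hΘpos : ∀ᵐ ω ∂P, 0 < Θ ω) {f : Ω → ℝ≥0∞} (hf : Measurable f) :
    ∫⁻ θ, ∫⁻ ω, f ω ∂(κ θ) ∂(lawOn P Θ) = ∫⁻ ω, f ω ∂P := by
  have h := hκ.setLIntegral_lintegral hΘ MeasurableSet.univ hf
  rw [Measure.restrict_univ] at h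
  rw [h, Set.image_univ, Subtype.range_coe]
  congr 1
  exact Measure.restrict_eq_self_of_ae_mem hΘpos

/-- To identify the images of the `P_θ` under a random element with values in a countably
generated space, it is enough to integrate over events of `Θ`. -/
lemma ae_map_eq [IsProbabilityMeasure P] {E : Type*} [MeasurableSpace E]
    [MeasurableSpace.CountablyGenerated E] {Y : Ω → E} (hY : Measurable Y)
    {η : Kernel (Set.Ioi (0 : ℝ)) E} [IsMarkovKernel η] {C : Set (Set E)}
    (hC : IsPiSystem C)
    (hgen : (inferInstance : MeasurableSpace E) = MeasurableSpace.generateFrom C)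
    (hCuniv : Set.univ ∈ C)
    (h : ∀ B, MeasurableSet B → ∀ D ∈ C,
      ∫⁻ θ in B, η θ D ∂(lawOn P Θ) = P (Y ⁻¹' D ∩ Θ ⁻¹' (Subtype.val '' B))) :
    ∀ᵐ θ ∂(lawOn P Θ), (κ θ).map Y = η θ := by
  have := hκ.markov
  have := isFiniteMeasure_lawOn (P := P) hΘ
  have hm : IsMarkovKernel (κ.map Y) := Kernel.IsMarkovKernel.map κ hY
  have hCm : ∀ D ∈ C, MeasurableSet D := fun D hD => by
    have := MeasurableSpace.measurableSet_generateFrom hD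
    rwa [← hgen] at this
  have hrect : ∀ B, MeasurableSet B → ∀ D, MeasurableSet D →
      ∫⁻ θ in B, (κ.map Y) θ D ∂(lawOn P Θ) = P (Y ⁻¹' D ∩ Θ ⁻¹' (Subtype.val '' B)) := by
    intro B hB D hD
    simp only [Kernel.map_apply' κ hY _ hD]
    exact hκ.setLIntegral_apply hΘ hB (hY hD)
  -- Equality of the joint laws gives almost sure equality of the kernels because E is countably
  -- generated.
  suffices hcomp : lawOn P Θ ⊗ₘ κ.map Y = lawOn P Θ ⊗ₘ η by
    filter_upwards [Kernel.ae_eq_of_compProd_eq hcomp] with θ hθ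
    rw [← hθ, Kernel.map_apply κ hY]
  have hgen2 : (inferInstance : MeasurableSpace (Set.Ioi (0 : ℝ) × E)) =
      MeasurableSpace.generateFrom (Set.image2 (· ×ˢ ·) {B | MeasurableSet B} C) := by
    refine (generateFrom_eq_prod MeasurableSpace.generateFrom_measurableSet hgen.symm ?_ ?_).symm
    · exact ⟨fun _ => Set.univ, fun _ => by simp, Set.iUnion_const _⟩
    · exact ⟨fun _ => Set.univ, fun _ => hCuniv, Set.iUnion_const _⟩
  refine ext_of_generate_finite _ hgen2
    (MeasurableSpace.isPiSystem_measurableSet.prod hC) ?_ ?_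
  · rintro _ ⟨B, hB, D, hD, rfl⟩
    rw [Set.mem_ofPred_eq] at hB
    rw [Measure.compProd_apply_prod hB (hCm D hD), Measure.compProd_apply_prod hB (hCm D hD),
      hrect B hB D (hCm D hD), h B hB D hD]
  · rw [← Set.univ_prod_univ, Measure.compProd_apply_prod MeasurableSet.univ MeasurableSet.univ,
      Measure.compProd_apply_prod MeasurableSet.univ MeasurableSet.univ]
    simp

/-- Consistency has one null set for each Borel set. Comparing the image of P_θ under `Θ` with the
point mass at θ merges them into a single null set. -/
lemma ae_param_eq [IsProbabilityMeasure P] :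
    ∀ᵐ θ : Set.Ioi (0 : ℝ) ∂(lawOn P Θ), ∀ᵐ ω ∂(κ θ), Θ ω = (θ : ℝ) := by
  have := hκ.markov
  have hval : Measurable (Subtype.val : Set.Ioi (0 : ℝ) → ℝ) := measurable_subtype_coe
  have := hκ.ae_map_eq hΘ hΘ (η := Kernel.deterministic Subtype.val hval)
    MeasurableSpace.isPiSystem_measurableSet MeasurableSpace.generateFrom_measurableSet.symm
    (by simp) (fun B hB D hD => ?_)
  · filter_upwards [this] with θ hθ
    have h1 : (κ θ).map Θ {(θ : ℝ)}ᶜ = 0 := by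
      rw [hθ, Kernel.deterministic_apply' _ _ (measurableSet_singleton _).compl]
      simp
    rwa [Measure.map_apply hΘ (measurableSet_singleton _).compl] at h1
  · rw [Set.mem_ofPred_eq] at hD
    simp only [Kernel.deterministic_apply' hval _ hD]
    have hD' : MeasurableSet (Subtype.val ⁻¹' D : Set (Set.Ioi (0 : ℝ))) := hval hD
    have : (fun θ : Set.Ioi (0 : ℝ) => D.indicator (fun _ => (1 : ℝ≥0∞)) (θ : ℝ))
        = (Subtype.val ⁻¹' D).indicator 1 := by
      funext θ; rfl
    rw [this, lintegral_indicator_one hD', Measure.restrict_apply hD',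
      lawOn_apply hΘ (hD'.inter hB)]
    congr 1
    ext ω
    simp only [Set.mem_preimage, Set.mem_image, Set.mem_inter_iff]
    constructor
    · rintro ⟨x, ⟨hx1, hx2⟩, hx3⟩
      exact ⟨hx3 ▸ hx1, x, hx2, hx3⟩
    · rintro ⟨h1, x, hx2, hx3⟩
      exact ⟨x, ⟨hx3 ▸ h1, hx2⟩, hx3⟩

/-- The counting process and the sizes remain independent under `P_θ`, and the law of the sizes
does not depend on `θ`. -/
lemma ae_indep [IsProbabilityMeasure P] {N : ℝ≥0 → Ω → ℕ} {X : ℕ → Ω → ℝ}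
    (hN : IsCountingProcess N) (hX : ∀ n, Measurable (X n))
    (hind : Indep (countSpace N Θ) (sizeSpace X) P) :
    ∀ᵐ θ ∂(lawOn P Θ), (∀ B, MeasurableSet[sizeSpace X] B → κ θ B = P B) ∧
      Indep (countSpace N Θ) (sizeSpace X) (κ θ) := by
  have := hκ.markov
  have := isFiniteMeasure_lawOn (P := P) hΘ
  -- `N` is sampled at the countably many grid points to obtain a countably generated target space;
  -- right continuity makes this sampling generate all of σ(N).
  set Y : Ω → (ℕ × ℕ → ℕ) := fun ω p => N (gridPoint p.1 p.2) ω with hY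
  set Z : Ω → (ℕ → ℝ) := fun ω n => X n ω with hZ
  have hYm : Measurable Y := measurable_pi_iff.2 fun p => hN.measurable _
  have hZm : Measurable Z := measurable_pi_iff.2 hX
  have hZprob : IsProbabilityMeasure (P.map Z) := Measure.isProbabilityMeasure_map hZm.aemeasurable
  have hκY : IsMarkovKernel (κ.map Y) := Kernel.IsMarkovKernel.map κ hYm
  have hYcount : ∀ G, MeasurableSet G → MeasurableSet[countSpace N Θ] (Y ⁻¹' G) := fun G hG => by
    have : Measurable[countSpace N Θ] Y :=
      @measurable_pi_lambda _ _ _ (countSpace N Θ) _ Y fun p => measurable_count (gridPoint p.1 p.2)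
    exact this hG
  have hjoint := hκ.ae_map_eq hΘ (hYm.prodMk hZm)
    (η := (κ.map Y) ×ₖ Kernel.const _ (P.map Z))
    (C := Set.image2 (· ×ˢ ·) {G | MeasurableSet G} {B | MeasurableSet B})
    isPiSystem_prod generateFrom_prod.symm
    ⟨Set.univ, by simp, Set.univ, by simp, Set.univ_prod_univ⟩
    (by
      rintro B hB _ ⟨G, hG, D, hD, rfl⟩
      rw [Set.mem_ofPred_eq] at hG hD
      have hΘB : MeasurableSet[countSpace N Θ] (Θ ⁻¹' (Subtype.val '' B)) :=
        (le_sup_right : sigmaOf Θ ≤ countSpace N Θ) _ ⟨_,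
          (MeasurableEmbedding.subtype_coe measurableSet_Ioi).measurableSet_image.2 hB, rfl⟩
      have hDX : MeasurableSet[sizeSpace X] (Z ⁻¹' D) := by
        rw [sizeSpace_eq_comap]; exact ⟨D, hD, rfl⟩
      simp only [Kernel.prod_apply_prod, Kernel.const_apply, Kernel.map_apply' κ hYm _ hG,
        Measure.map_apply hZm hD]
      rw [lintegral_mul_const _ (κ.measurable_coe (hYm hG)), hκ.setLIntegral_apply hΘ hB (hYm hG),
        ← (Indep_iff _ _ _).1 hind _ _ (MeasurableSet.inter (hYcount G hG) hΘB) hDX]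
      congr 1
      ext ω
      simp only [Set.mem_inter_iff, Set.mem_preimage, Set.mem_prod]
      tauto)
  filter_upwards [hjoint, hκ.ae_param_eq hΘ] with θ hθ hΘθ
  have hrect : ∀ G D, MeasurableSet G → MeasurableSet D →
      κ θ (Y ⁻¹' G ∩ Z ⁻¹' D) = κ θ (Y ⁻¹' G) * P (Z ⁻¹' D) := by
    intro G D hG hD
    have := congrArg (fun ν => ν (G ×ˢ D)) hθ
    simp only [Kernel.prod_apply_prod, Kernel.const_apply, Kernel.map_apply' κ hYm _ hG,
      Measure.map_apply hZm hD, Measure.map_apply (hYm.prodMk hZm) (hG.prod hD)] at this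
    exact this
  have hlaw : ∀ B, MeasurableSet[sizeSpace X] B → κ θ B = P B := by
    intro B hB
    rw [sizeSpace_eq_comap] at hB
    obtain ⟨D, hD, rfl⟩ := hB
    simpa using hrect Set.univ D MeasurableSet.univ hD
  refine ⟨hlaw, ?_⟩
  rw [Indep_iff]
  intro A B hA hB
  have hBm : MeasurableSet B := (iSup_le fun n => (hX n).comap_le : sizeSpace X ≤ mΩ) B hB
  have hNle : (⨆ t, MeasurableSpace.comap (N t) inferInstance)
      ≤ MeasurableSpace.comap Y inferInstance := by
    refine iSup_le fun t => Measurable.comap_le ?_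
    refine @measurable_of_tendsto_metrizable _ _ (MeasurableSpace.comap Y inferInstance) _ _ _ _
      (fun n => N (gridPoint n (gridNum n t))) _ (fun n => ?_)
      (tendsto_pi_nhds.2 fun ω => tendsto_const_nhds.congr'
        ((hN.eventually_gridPoint ω t).mono fun n hn => hn.symm))
    exact (measurable_pi_apply (n, gridNum n t)).comp (comap_measurable Y)
  have hYle : MeasurableSpace.comap Y inferInstance ≤ mΩ := hYm.comap_le
  have hAm : MeasurableSet A := (sup_le (hNle.trans hYle) hΘ.comap_le : countSpace N Θ ≤ mΩ) A hA
  -- Under P_θ the variable `Θ` is constant, so σ(Θ) is trivial and can be joined to σ(N) without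
  -- affecting independence.
  have h01 : ∀ F, MeasurableSet[sigmaOf Θ] F → κ θ F = 0 ∨ κ θ Fᶜ = 0 := by
    rintro _ ⟨F, hF, rfl⟩
    by_cases hθF : (θ : ℝ) ∈ F
    · right
      refine measure_mono_null (fun ω hω => ?_) hΘθ
      intro h
      apply hω
      change Θ ω ∈ F
      rwa [h]
    · left
      refine measure_mono_null (fun ω hω => ?_) hΘθ
      intro h
      apply hθF
      rw [← h]
      exact hω
  have hfin := measure_eq_of_sup (μ := (κ θ).restrict B) (ν := κ θ B • κ θ) (hNle.trans hYle)
    hΘ.comap_le (fun G F hG hF => ?_) hA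
  · rwa [Measure.restrict_apply hAm, Measure.smul_apply, smul_eq_mul, mul_comm] at hfin
  · have hGm : MeasurableSet G := hYle G (hNle G hG)
    have hFm : MeasurableSet F := hΘ.comap_le F hF
    rw [Measure.restrict_apply (hGm.inter hFm), Measure.smul_apply, smul_eq_mul]
    rcases h01 F hF with h0 | h0
    · rw [measure_mono_null (s := G ∩ F ∩ B) (fun ω hω => hω.1.2) h0,
        measure_mono_null (s := G ∩ F) (fun ω hω => hω.2) h0, mul_zero]
    · rw [Set.inter_right_comm, measure_inter_conull h0, measure_inter_conull h0]
      obtain ⟨G', hG', rfl⟩ := hNle G hG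
      rw [hlaw B hB, mul_comm]
      rw [sizeSpace_eq_comap] at hB
      obtain ⟨D, hD, rfl⟩ := hB
      exact hrect G' D hG' hD

/-- An intensity identity holds under `P` if and only if it holds under almost all `P_θ`. -/
lemma hasIntensity_iff [IsProbabilityMeasure P] (hΘpos : ∀ᵐ ω ∂P, 0 < Θ ω)
    {N : ℝ≥0 → Ω → ℕ} (hN : IsCountingProcess N) :
    HasIntensity P (filtrationWith N Θ hN.measurable hΘ) (fun t ω => (N t ω : ℝ)) Θ ↔
    ∀ᵐ θ ∂(lawOn P Θ), HasIntensity (κ θ) (filtrationWith N Θ hN.measurable hΘ)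
      (fun t ω => (N t ω : ℝ)) Θ := by
  have := hκ.markov
  have := isFiniteMeasure_lawOn (P := P) hΘ
  have hincm : ∀ u v : ℝ≥0, Measurable fun ω => ENNReal.ofReal ((N v ω : ℝ) - N u ω) := fun u v =>
    (((measurable_from_top (f := fun k : ℕ => (k : ℝ))).comp (hN.measurable v)).sub
      ((measurable_from_top (f := fun k : ℕ => (k : ℝ))).comp (hN.measurable u))).ennreal_ofReal
  constructor
  · intro h
    have hgrid := h.grid hN hΘ
    have hcyl : ∀ (n i : ℕ) (J : {J : Finset (ℕ × ℕ) // ∀ p ∈ J, p.1 ≤ i}),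
        ∀ᵐ θ ∂(lawOn P Θ),
        ∫⁻ ω in {ω | ∀ p ∈ J.1, N (gridPoint n p.1) ω = p.2},
          ENNReal.ofReal ((N (gridPoint n (i + 1)) ω : ℝ) - N (gridPoint n i) ω) ∂(κ θ)
        = ∫⁻ ω in {ω | ∀ p ∈ J.1, N (gridPoint n p.1) ω = p.2},
          ENNReal.ofReal (1 / ((n : ℝ) + 1)) * ENNReal.ofReal (Θ ω) ∂(κ θ) := by
      intro n i J
      have hEm : MeasurableSet {ω | ∀ p ∈ J.1, N (gridPoint n p.1) ω = p.2} := by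
        have : {ω | ∀ p ∈ J.1, N (gridPoint n p.1) ω = p.2}
            = ⋂ p ∈ J.1, N (gridPoint n p.1) ⁻¹' {p.2} := by ext; simp
        rw [this]
        exact Finset.measurableSet_biInter _ fun p _ => hN.measurable _ (measurableSet_singleton _)
      have hgm : Measurable fun ω => ENNReal.ofReal (1 / ((n : ℝ) + 1)) * ENNReal.ofReal (Θ ω) :=
        hΘ.ennreal_ofReal.const_mul _
      simp only [← lintegral_indicator hEm]
      -- Two functions of θ agree almost everywhere once their integrals over every B do, and these
      -- integrals are the identity under P on {Θ ∈ B}.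
      refine ae_eq_of_forall_setLIntegral_eq_of_sigmaFinite
        ((hincm _ _).indicator hEm).lintegral_kernel (hgm.indicator hEm).lintegral_kernel
        fun B hB _ => ?_
      rw [hκ.setLIntegral_lintegral hΘ hB ((hincm _ _).indicator hEm),
        hκ.setLIntegral_lintegral hΘ hB (hgm.indicator hEm), setLIntegral_indicator hEm,
        setLIntegral_indicator hEm, Set.inter_comm, lintegral_const_mul _ hΘ.ennreal_ofReal]
      exact hgrid n i J.1 J.2 _
        ((MeasurableEmbedding.subtype_coe measurableSet_Ioi).measurableSet_image.2 hB)
    have hall := ae_all_iff.2 fun n => ae_all_iff.2 fun i => ae_all_iff.2 fun J => hcyl n i J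
    filter_upwards [hall, hκ.ae_param_eq hΘ] with θ hθ hΘθ
    have hint : Integrable Θ (κ θ) := (integrable_const (θ : ℝ)).congr (by
      filter_upwards [hΘθ] with ω hω using hω.symm)
    refine HasGridIntensity.hasIntensity (fun n i J hJ F hF => ?_) hN hΘ hint
    rw [← lintegral_const_mul _ hΘ.ennreal_ofReal]
    -- The uncountably many events of `Θ` cost no further null sets: under P_θ each has probability
    -- 0 or 1, according to whether θ lies in F.
    by_cases hθF : (θ : ℝ) ∈ F
    · have hae : (Θ ⁻¹' F ∩ {ω | ∀ p ∈ J, N (gridPoint n p.1) ω = p.2} : Set Ω)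
          =ᵐ[κ θ] {ω | ∀ p ∈ J, N (gridPoint n p.1) ω = p.2} := by
        filter_upwards [hΘθ] with ω hω
        refine propext ⟨fun h => h.2, fun h => ⟨?_, h⟩⟩
        change Θ ω ∈ F
        rwa [hω]
      rw [setLIntegral_congr hae, setLIntegral_congr hae]
      exact hθ n i ⟨J, hJ⟩
    · have hnull : κ θ (Θ ⁻¹' F ∩ {ω | ∀ p ∈ J, N (gridPoint n p.1) ω = p.2}) = 0 := by
        refine measure_mono_null (fun ω hω => ?_) hΘθ
        intro h'
        apply hθF
        rw [← h']
        exact hω.1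
      rw [setLIntegral_measure_zero _ _ hnull, setLIntegral_measure_zero _ _ hnull]
  · intro h s t hst A hA
    have hAm : MeasurableSet A := Filtration.le _ s A hA
    have hgm : Measurable fun ω => ENNReal.ofReal (t - s) * ENNReal.ofReal (Θ ω) :=
      hΘ.ennreal_ofReal.const_mul _
    rw [← lintegral_const_mul _ hΘ.ennreal_ofReal, ← lintegral_indicator hAm,
      ← lintegral_indicator hAm, ← hκ.lintegral_lintegral hΘ hΘpos ((hincm s t).indicator hAm),
      ← hκ.lintegral_lintegral hΘ hΘpos (hgm.indicator hAm)]
    refine lintegral_congr_ae ?_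
    filter_upwards [h] with θ hθ
    rw [lintegral_indicator hAm, lintegral_indicator hAm, lintegral_const_mul _ hΘ.ennreal_ofReal]
    exact hθ s t hst A hA

end IsConsistentRCP

end Disintegration

/-! ### Martingale criteria under P and under P_θ -/

section Equivalences

variable {Ω : Type*} {mΩ : MeasurableSpace Ω} {μ P : Measure Ω} {N : ℝ≥0 → Ω → ℕ}
  {X : ℕ → Ω → ℝ} {Θ : Ω → ℝ}

lemma hasIntensity_congr {ℱ : Filtration ℝ≥0 mΩ} {Z : ℝ≥0 → Ω → ℝ} {Λ Λ' : Ω → ℝ}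
    (h : Λ =ᵐ[μ] Λ') : HasIntensity μ ℱ Z Λ ↔ HasIntensity μ ℱ Z Λ' := by
  have e : ∀ A, ∫⁻ ω in A, ENNReal.ofReal (Λ ω) ∂μ = ∫⁻ ω in A, ENNReal.ofReal (Λ' ω) ∂μ :=
    fun A => lintegral_congr_ae (by filter_upwards [ae_restrict_of_ae h] with ω hω using by rw [hω])
  simp only [HasIntensity, e]

/-- The version Λ of `Θ` is kept apart so that one statement serves P, with Λ = Θ, and P_θ, with Λ
the constant θ. -/
lemma martingale_count_iff [IsFiniteMeasure μ] (hN : IsCountingProcess N) (hΘ : Measurable Θ)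
    (hΘint : Integrable Θ μ) {Λ : Ω → ℝ}
    (hΛm : Measurable[filtrationWith N Θ hN.measurable hΘ 0] Λ) (hΛ : Θ =ᵐ[μ] Λ)
    (hΛ0 : 0 ≤ᵐ[μ] Λ) :
    Martingale (fun (t : ℝ≥0) ω => (N t ω : ℝ) - t * Λ ω)
      (filtrationWith N Θ hN.measurable hΘ) μ ↔
    HasIntensity μ (filtrationWith N Θ hN.measurable hΘ) (fun t ω => (N t ω : ℝ)) Θ := by
  rw [martingale_iff_hasIntensity (Z := fun t ω => (N t ω : ℝ))
    (fun t => (measurable_from_top (f := fun k : ℕ => (k : ℝ))).comp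
      (measurable_filtrationWith hN.measurable hΘ le_rfl))
    (fun ω s t hst => Nat.cast_le.2 (hN.monotone ω hst)) (fun ω => by simp [hN.zero])
    hΛm (hΘint.congr hΛ) hΛ0]
  exact hasIntensity_congr hΛ.symm

lemma IsCompoundModel.martingale_aggregate_iff [IsProbabilityMeasure μ] {c : ℝ≥0∞}
    (h : IsCompoundModel μ N X Θ c) (hc0 : c ≠ 0) (hc : c ≠ ∞) (hΘint : Integrable Θ μ)
    {Λ : Ω → ℝ} (hΛm : Measurable[filtrationWith (aggregate N X) Θ h.measurable_aggregate
      h.measurable_param 0] Λ) (hΛ : Θ =ᵐ[μ] Λ) (hΛ0 : 0 ≤ᵐ[μ] Λ) :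
    Martingale (fun (t : ℝ≥0) ω => aggregate N X t ω - t * Λ ω * ∫ ω', X 0 ω' ∂μ)
      (filtrationWith (aggregate N X) Θ h.measurable_aggregate h.measurable_param) μ ↔
    HasIntensity μ (filtrationWith N Θ h.counting.measurable h.measurable_param)
      (fun t ω => (N t ω : ℝ)) Θ := by
  have hmean : ∫ ω', X 0 ω' ∂μ = c.toReal := by
    rw [integral_eq_lintegral_of_nonneg_ae (Eventually.of_forall fun ω => (h.size_pos 0 ω).le)
      (h.measurable_size 0).aestronglyMeasurable, h.mean_eq]
  rw [← h.hasIntensity_aggregate_iff hc0 hc hΘint, hmean]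
  simp only [mul_assoc]
  rw [martingale_iff_hasIntensity (Z := aggregate N X) (Λ := fun ω => Λ ω * c.toReal)
    (fun t => measurable_filtrationWith h.measurable_aggregate h.measurable_param le_rfl)
    (fun ω s t hst => (strictMono_partialSums fun n => h.size_pos n ω).monotone
      (h.counting.monotone ω hst))
    (fun ω => by simp [aggregate, h.counting.zero]) (hΛm.mul_const _)
    ((hΘint.congr hΛ).mul_const _)
    (by filter_upwards [hΛ0] with ω hω using mul_nonneg hω ENNReal.toReal_nonneg)]
  exact hasIntensity_congr (by filter_upwards [hΛ] with ω hω using by rw [hω])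

/-- The conditions (a1) and (a2) make `(N, Θ)` and `X` independent. -/
lemma indep_of_conditions [IsProbabilityMeasure P] (hΘ : Measurable Θ)
    (hNX : IsRiskProcess P N X) (ha1 : ConditionA1 P N X Θ) (ha2 : ConditionA2 P X Θ) :
    Indep (countSpace N Θ) (sizeSpace X) P := by
  have hX := hNX.measurable_size
  have hXle : sizeSpace X ≤ mΩ := iSup_le fun n => (hX n).comap_le
  have hWle : (⨆ n, MeasurableSpace.comap (interarrival N n) inferInstance) ≤ mΩ :=
    iSup_le fun n => (measurable_interarrival hNX.counting n).comap_le
  -- Condition (a1) speaks of interarrival times, which determine the counting process.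
  have hNW : (⨆ t, MeasurableSpace.comap (N t) inferInstance)
      ≤ ⨆ n, MeasurableSpace.comap (interarrival N n) inferInstance :=
    iSup_le fun t => (measurable_counting_of_interarrival hNX.counting (fun n =>
      Measurable.of_comap_le (le_iSup (fun n => MeasurableSpace.comap (interarrival N n)
        inferInstance) n)) t).comap_le
  rw [Indep_iff]
  intro A B hA hB
  have hBm : MeasurableSet B := hXle B hB
  have hAm : MeasurableSet A :=
    (sup_le (hNW.trans hWle) hΘ.comap_le : countSpace N Θ ≤ mΩ) A hA
  have hΘB : P⟦B | sigmaOf Θ⟧ =ᵐ[P] fun _ => P.real B := by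
    have hi : Indep (sizeSpace X) (sigmaOf Θ) P := by
      rw [sizeSpace_eq_comap]
      exact ((IndepFun_iff_Indep _ _ _).1 ha2).symm
    have := condExp_indep_eq hXle hΘ.comap_le
      ((stronglyMeasurable_const (b := (1 : ℝ))).indicator hB) hi
    refine this.trans (Eventually.of_forall fun ω => ?_)
    simp only
    rw [integral_indicator hBm, setIntegral_const, smul_eq_mul, mul_one]
  have hfin := measure_eq_of_sup (μ := P.restrict B) (ν := P B • P) (hNW.trans hWle)
    hΘ.comap_le (fun G F hG hF => ?_) hA
  · rwa [Measure.restrict_apply hAm, Measure.smul_apply, smul_eq_mul, mul_comm] at hfin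
  · have hGm : MeasurableSet G := hWle G (hNW G hG)
    have hFm : MeasurableSet F := hΘ.comap_le F hF
    have hint : ∀ S, MeasurableSet S → Integrable (S.indicator fun _ => (1 : ℝ)) P :=
      fun S hS => (integrable_const (1 : ℝ)).indicator hS
    have hreal : ∀ S, MeasurableSet S →
        ∫ ω in F, (P⟦S | sigmaOf Θ⟧) ω ∂P = P.real (S ∩ F) := fun S hS => by
      rw [setIntegral_condExp hΘ.comap_le (hint S hS) hF, integral_indicator hS,
        Measure.restrict_restrict hS, setIntegral_const, smul_eq_mul, mul_one]
    -- By (a1) the conditional probability of G ∩ B given `Θ` is a product, and by (a2) its second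
    -- factor is the constant P(B); integrating over F gives the claim.
    have key : P.real (G ∩ B ∩ F) = P.real B * P.real (G ∩ F) := by
      rw [← hreal _ (hGm.inter hBm), ← hreal G hGm, ← integral_const_mul]
      refine integral_congr_ae (ae_restrict_of_ae ?_)
      filter_upwards [ha1 G B (hNW G hG) hB, hΘB] with ω h1 h2
      rw [h1, Pi.mul_apply, h2, mul_comm]
    rw [Measure.restrict_apply (hGm.inter hFm), Measure.smul_apply, smul_eq_mul,
      Set.inter_right_comm]
    simp only [measureReal_def, ← ENNReal.toReal_mul] at key
    exact (ENNReal.toReal_eq_toReal_iff' (measure_ne_top _ _)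
      (ENNReal.mul_ne_top (measure_ne_top _ _) (measure_ne_top _ _))).1 key

lemma isCompoundModel_of_conditions [IsProbabilityMeasure P] (hΘ : Measurable Θ)
    (hNX : IsRiskProcess P N X) (ha1 : ConditionA1 P N X Θ) (ha2 : ConditionA2 P X Θ) :
    IsCompoundModel P N X Θ (∫⁻ ω, ENNReal.ofReal (X 0 ω) ∂P) where
  counting := hNX.counting
  measurable_param := hΘ
  measurable_size := hNX.measurable_size
  size_pos := hNX.size_pos
  size_indep := hNX.size_indep
  mean_eq n := ((hNX.size_identDistrib n).comp ENNReal.measurable_ofReal).lintegral_eq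
  indep := indep_of_conditions hΘ hNX ha1 ha2

/-- The compound model is inherited by measures under which the sizes have the same law. -/
lemma IsCompoundModel.of_law_eq {c : ℝ≥0∞} (h : IsCompoundModel P N X Θ c)
    (hlaw : ∀ B, MeasurableSet[sizeSpace X] B → μ B = P B)
    (hind : Indep (countSpace N Θ) (sizeSpace X) μ) : IsCompoundModel μ N X Θ c := by
  have hle : ∀ n, MeasurableSpace.comap (X n) inferInstance ≤ sizeSpace X := fun n =>
    le_iSup (fun n => MeasurableSpace.comap (X n) inferInstance) n
  refine ⟨h.counting, h.measurable_param, h.measurable_size, h.size_pos, ?_, fun n => ?_, hind⟩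
  · rw [iIndepFun_iff_measure_inter_preimage_eq_mul]
    intro S B hB
    have hm : ∀ i ∈ S, MeasurableSet[sizeSpace X] (X i ⁻¹' B i) := fun i hi =>
      hle i _ ⟨B i, hB i hi, rfl⟩
    rw [hlaw _ (Finset.measurableSet_biInter S hm),
      (iIndepFun_iff_measure_inter_preimage_eq_mul.1 h.size_indep) S hB]
    exact Finset.prod_congr rfl fun i hi => (hlaw _ (hm i hi)).symm
  · have htrim : μ.trim h.sizeSpace_le = P.trim h.sizeSpace_le := by
      refine @Measure.ext _ (sizeSpace X) _ _ fun B hB => ?_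
      rw [trim_measurableSet_eq _ hB, trim_measurableSet_eq _ hB, hlaw B hB]
    have hm : Measurable[sizeSpace X] fun ω => ENNReal.ofReal (X n ω) :=
      (Measurable.of_comap_le (hle n)).ennreal_ofReal
    rw [← h.mean_eq n, ← lintegral_trim h.sizeSpace_le hm, htrim, lintegral_trim _ hm]

end Equivalences

end CompoundPoisson

theorem theorem3p4 {Ω : Type*} [MeasurableSpace Ω] (P : Measure Ω) [IsProbabilityMeasure P]
    (Θ : Ω → ℝ) (hΘ : Measurable Θ) (hΘpos : ∀ᵐ ω ∂P, 0 < Θ ω)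
    (N : ℝ≥0 → Ω → ℕ) (X : ℕ → Ω → ℝ) (hNX : IsRiskProcess P N X)
    (ha1 : ConditionA1 P N X Θ) (ha2 : ConditionA2 P X Θ)
    (hX1 : Integrable (X 0) P) (hΘint : Integrable Θ P)
    (κ : Kernel (Set.Ioi (0 : ℝ)) Ω) (hκ : IsConsistentRCP P Θ κ) :
    [IsCMPP P Θ (P.map (X 0)) (aggregate N X),
      Martingale (fun (t : ℝ≥0) ω => aggregate N X t ω - t * Θ ω * ∫ ω', X 0 ω' ∂P)
        (filtrationS hNX hΘ) P,
      ∀ᵐ θ : Set.Ioi (0 : ℝ) ∂(lawOn P Θ),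
        Martingale (fun (t : ℝ≥0) ω => aggregate N X t ω - t * (θ : ℝ) * ∫ ω', X 0 ω' ∂(κ θ))
          (filtrationS hNX hΘ) (κ θ),
      Martingale (fun (t : ℝ≥0) ω => (N t ω : ℝ) - t * Θ ω) (filtrationN hNX hΘ) P,
      ∀ᵐ θ : Set.Ioi (0 : ℝ) ∂(lawOn P Θ),
        Martingale (fun (t : ℝ≥0) ω => (N t ω : ℝ) - t * (θ : ℝ))
          (filtrationN hNX hΘ) (κ θ)].TFAE := by
  have := hκ.markov
  have hN := hNX.counting
  have hΘ0 : 0 ≤ᵐ[P] Θ := hΘpos.mono fun ω hω => hω.le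
  have hmodel := isCompoundModel_of_conditions hΘ hNX ha1 ha2
  have hc : ∫⁻ ω, ENNReal.ofReal (X 0 ω) ∂P ≠ ∞ :=
    (lt_of_le_of_lt (lintegral_mono fun ω => Real.ofReal_le_enorm (X 0 ω)) hX1.2).ne
  -- A nonzero finite mean is what allows it to be cancelled in Wald's identity.
  have hc0 : ∫⁻ ω, ENNReal.ofReal (X 0 ω) ∂P ≠ 0 := by
    rw [Ne, lintegral_eq_zero_iff (hNX.measurable_size 0).ennreal_ofReal]
    intro h0
    obtain ⟨ω, hω⟩ := h0.exists
    exact absurd (ENNReal.ofReal_eq_zero.1 hω) (not_le.2 (hNX.size_pos 0 ω))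
  have hcount : Martingale (fun (t : ℝ≥0) ω => (N t ω : ℝ) - t * Θ ω) (filtrationN hNX hΘ) P ↔
      HasIntensity P (filtrationWith N Θ hN.measurable hΘ) (fun t ω => (N t ω : ℝ)) Θ :=
    martingale_count_iff hN hΘ hΘint (measurable_filtrationWith_param hN.measurable hΘ 0)
      (ae_eq_refl Θ) hΘ0
  have hcond : ∀ᵐ θ : Set.Ioi (0 : ℝ) ∂(lawOn P Θ),
      (Martingale (fun (t : ℝ≥0) ω => (N t ω : ℝ) - t * (θ : ℝ)) (filtrationN hNX hΘ) (κ θ) ↔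
        HasIntensity (κ θ) (filtrationWith N Θ hN.measurable hΘ) (fun t ω => (N t ω : ℝ)) Θ) ∧
      (Martingale (fun (t : ℝ≥0) ω => aggregate N X t ω - t * (θ : ℝ) * ∫ ω', X 0 ω' ∂(κ θ))
          (filtrationS hNX hΘ) (κ θ) ↔
        HasIntensity (κ θ) (filtrationWith N Θ hN.measurable hΘ) (fun t ω => (N t ω : ℝ)) Θ) := by
    filter_upwards [hκ.ae_param_eq hΘ,
      hκ.ae_indep hΘ hN hNX.measurable_size hmodel.indep] with θ hθ ⟨hlaw, hind⟩
    have hint : Integrable Θ (κ θ) := (integrable_const (θ : ℝ)).congr (by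
      filter_upwards [hθ] with ω hω using hω.symm)
    have hpos : 0 ≤ᵐ[κ θ] fun _ => (θ : ℝ) :=
      Filter.Eventually.of_forall fun _ => (Set.mem_Ioi.1 θ.2).le
    exact ⟨martingale_count_iff hN hΘ hint measurable_const hθ hpos,
      (hmodel.of_law_eq hlaw hind).martingale_aggregate_iff hc0 hc hint measurable_const hθ hpos⟩
  tfae_have 2 ↔ 4 :=
    (hmodel.martingale_aggregate_iff hc0 hc hΘint
      (measurable_filtrationWith_param hmodel.measurable_aggregate hΘ 0)
      (ae_eq_refl Θ) hΘ0).trans hcount.symm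
  tfae_have 3 ↔ 5 :=
    Filter.eventually_congr (hcond.mono fun θ h => h.2.trans h.1.symm)
  tfae_have 4 ↔ 5 :=
    hcount.trans ((hκ.hasIntensity_iff hΘ hΘpos hN).trans
      (Filter.eventually_congr (hcond.mono fun θ h => h.1.symm)))
  tfae_have 1 → 4 := by
    rintro ⟨N', X', hNX', hS, -, hmixed⟩
    -- The representing pair need not be the given one, but its counting process is, since both
    -- produce the same `S`.
    obtain rfl : N = N' := counting_unique hN hNX'.counting hNX.size_pos hNX'.size_pos hS
    exact hcount.2 ((hmixed.hasGridIntensity hΘ).hasIntensity hN hΘ hΘint)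
  tfae_have 4 → 1 := fun hM =>
    ⟨N, X, hNX, rfl, rfl, isMixedPoisson_of_martingale hN hΘ hΘint hΘ0 hM⟩
  tfae_finish
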